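/- Let $H$ be a separable complex Hilbert space and let $A:D(A)\subset H\to H$ be the infinitesimal generator of an analytic $C_0$-semigroup $S(\cdot)$ on $H$ such that the resolvent set of $A$ contains every $\lambda\in\mathbb C$ with $\operatorname{Re}\lambda\ge 0$. For $\gamma\ge 0$ let $\dot H^\gamma$ be the domain of the fractional power $(-A)^{\gamma/2}$ with the norm $\|x\|_\gamma:=\|(-A)^{\gamma/2}x\|$, where $(-A)^{0}=\mathrm{Id}$ and, for $\sigma>0$, $(-A)^{\sigma}$ is the inverse of the injective bounded operator $(-A)^{-\sigma}=\frac1{\Gamma(\sigma)}\int_0^\infty t^{\sigma-1}S(t)\,\mathrm dt$. Let $0<T<\infty$. For $\delta\ge 0$ let $\mathcal C^\delta([0,T];\dot H^\theta)$ be the space of continuous functions $u:[0,T]\to\dot H^\theta$ for which the norm $$\sup_{t\in[0,T]}\|u(t)\|_\theta+\sup_{t,s\in[0,T],\,t\ne s}\frac{\|u(t)-u(s)\|_\theta}{|t-s|^\delta}$$ is finite. Let $1<p<\infty$, $1/p<\alpha<1$ and $\rho,\theta,\delta\ge 0$. Suppose that one of the following conditions holds: 1. $\theta>\rho$, $\alpha>(\theta-\rho)/2+1/p$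 and $\delta=\alpha-1/p-(\theta-\rho)/2$; 2. $\theta=\rho$ and $\delta<\alpha-1/p$; 3. $\theta<\rho$ and $\delta=\alpha-1/p$. Then the formula $$R_\alpha f(t)=\int_0^t (t-r)^{\alpha-1}S(t-r)f(r)\,\mathrm dr,\qquad t\in[0,T],$$ in which the integral converges as a Bochner integral in $H$ for every $f\in L^p(0,T;\dot H^\rho)$ and every $t\in[0,T]$, defines a bounded linear operator $R_\alpha$ from $L^p(0,T;\dot H^\rho)$ to $\mathcal C^\delta([0,T];\dot H^\theta)$. -/

import Mathlib

open Filter MeasureTheory Topology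
open scoped NNReal ENNReal

noncomputable section

/-- A `C₀`-semigroup of bounded operators on a complex normed space. Only the values `S t` with
`0 ≤ t` are meaningful. -/
structure C0Semigroup (E : Type*) [NormedAddCommGroup E] [NormedSpace ℂ E] where
  /-- The operators `S t`. -/
  toFun : ℝ → E →L[ℂ] E
  op_zero : toFun 0 = ContinuousLinearMap.id ℂ E
  op_add : ∀ s t : ℝ, 0 ≤ s → 0 ≤ t → toFun (s + t) = (toFun s).comp (toFun t)
  strongly_continuous : ∀ x : E, Tendsto (fun t => toFun t x) (𝓝[>] 0) (𝓝 x)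

/-- The resolvent set of an unbounded operator `A`: those `z` for which `z - A` is a bijection from
the domain of `A` onto `E` with bounded inverse `R`. -/
def LinearPMap.resolventSet {E : Type*} [NormedAddCommGroup E] [NormedSpace ℂ E]
    (A : E →ₗ.[ℂ] E) : Set ℂ :=
  {z | ∃ R : E →L[ℂ] E,
    (∀ x : E, ∃ h : R x ∈ A.domain, z • R x - A ⟨R x, h⟩ = x) ∧
    (∀ x : A.domain, R (z • (x : E) - A x) = x)}

/-- The open sector of half-angle `φ` around the positive real axis. -/
def openSector (φ : ℝ) : Set ℂ := {z | z ≠ 0 ∧ |z.arg| < φ}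

namespace C0Semigroup

section Generator

variable {E : Type*} [NormedAddCommGroup E] [NormedSpace ℂ E]

/-- The graph of the infinitesimal generator: the pairs `(x, y)` such that
`(S h x - x) / h → y` as `h ↓ 0`. -/
def generatorGraph (S : C0Semigroup E) : Submodule ℂ (E × E) where
  carrier := {q | Tendsto (fun h : ℝ => h⁻¹ • (S.toFun h q.1 - q.1)) (𝓝[>] 0) (𝓝 q.2)}
  add_mem' := by
    intro a b ha hb
    refine (Tendsto.add ha hb).congr fun h => ?_
    simp only [Prod.fst_add, map_add, ← smul_add]
    congr 1
    abel
  zero_mem' := by simp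
  smul_mem' := by
    intro c a ha
    refine (Tendsto.const_smul ha c).congr fun h => ?_
    simp only [Prod.smul_fst, map_smul, ← smul_sub]
    exact smul_comm _ _ _

/-- The infinitesimal generator of `S`, with domain the set of all `x` for which
`lim_{h ↓ 0} (S h x - x) / h` exists. -/
def generator (S : C0Semigroup E) : E →ₗ.[ℂ] E := S.generatorGraph.toLinearPMap

theorem generator_graph (S : C0Semigroup E) : S.generator.graph = S.generatorGraph := by
  refine Submodule.toLinearPMap_graph_eq _ ?_
  rintro ⟨x, y⟩ hx hx0
  have hx' : Tendsto (fun h : ℝ => h⁻¹ • (S.toFun h x - x)) (𝓝[>] 0) (𝓝 y) := hx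
  have h0 : x = 0 := hx0
  subst h0
  simp only [map_zero, sub_zero, smul_zero] at hx'
  exact tendsto_nhds_unique hx' tendsto_const_nhds

/-- `S` is an analytic semigroup: it extends to a semigroup of bounded operators, holomorphic in an
open sector around the positive real axis and strongly continuous at `0` within that sector. -/
def IsAnalytic (S : C0Semigroup E) : Prop :=
  ∃ φ : ℝ, 0 < φ ∧ φ ≤ Real.pi / 2 ∧ ∃ V : ℂ → E →L[ℂ] E,
    (∀ t : ℝ, 0 ≤ t → V t = S.toFun t) ∧
    DifferentiableOn ℂ V (openSector φ) ∧
    (∀ z ∈ openSector φ, ∀ w ∈ openSector φ, V (z + w) = (V z).comp (V w)) ∧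
    (∀ x : E, Tendsto (fun z => V z x) (𝓝[openSector φ] 0) (𝓝 x))

end Generator

section FractionalPowers

variable {H : Type*} [NormedAddCommGroup H] [InnerProductSpace ℂ H] [CompleteSpace H]

/-- The negative fractional power `(-A)^{-γ}`, `γ ≥ 0`, of the generator `A` of `S`:
`(-A)^{-γ} = Γ(γ)⁻¹ ∫₀^∞ t^{γ-1} S(t) dt` for `γ > 0`, and `(-A)^0 = Id`. The integral converges in
operator norm when `S` is analytic and the closed right half-plane lies in the resolvent set of `A`,
because `S` is then norm continuous on `(0, ∞)` and decays exponentially. -/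
def negPow (S : C0Semigroup H) (γ : ℝ) : H →L[ℂ] H :=
  if γ = 0 then ContinuousLinearMap.id ℂ H
  else (Real.Gamma γ)⁻¹ • ∫ t in Set.Ioi (0 : ℝ), t ^ (γ - 1) • S.toFun t

theorem isCompl_ker_negPow (S : C0Semigroup H) (γ : ℝ) :
    IsCompl (LinearMap.ker (S.negPow γ : H →ₗ[ℂ] H))ᗮ
      (LinearMap.ker (S.negPow γ : H →ₗ[ℂ] H)) := by
  have : CompleteSpace (LinearMap.ker (S.negPow γ : H →ₗ[ℂ] H)) :=
    (S.negPow γ).isClosed_ker.completeSpace_coe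
  exact (Submodule.isCompl_orthogonal _).symm

/-- The fractional power `(-A)^γ`, `γ ≥ 0`, as an unbounded operator: the inverse of `(-A)^{-γ}`,
with domain the range of `(-A)^{-γ}`. Its value at `x` is the preimage of `x` under `(-A)^{-γ}` that
is orthogonal to the kernel of `(-A)^{-γ}`. That kernel is trivial for the semigroups for which
`(-A)^{-γ}` is defined (see `negPow`), and then this is the inverse (see `fracPow_negPow`); the
orthogonality merely makes the expression linear and injective in every case. -/
def fracPow (S : C0Semigroup H) (γ : ℝ) : H →ₗ.[ℂ] H where
  domain := LinearMap.range (S.negPow γ : H →ₗ[ℂ] H)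
  toFun := (LinearMap.ker (S.negPow γ : H →ₗ[ℂ] H))ᗮ.subtype ∘ₗ
    ((S.negPow γ : H →ₗ[ℂ] H).kerComplementEquivRange
      (S.isCompl_ker_negPow γ)).symm.toLinearMap

theorem negPow_fracPow (S : C0Semigroup H) (γ : ℝ) (x : (S.fracPow γ).domain) :
    S.negPow γ (S.fracPow γ x) = x :=
  congrArg Subtype.val (((S.negPow γ : H →ₗ[ℂ] H).kerComplementEquivRange
    (S.isCompl_ker_negPow γ)).apply_symm_apply x)

theorem fracPow_injective (S : C0Semigroup H) (γ : ℝ) :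
    Function.Injective (S.fracPow γ).toFun := by
  intro x y h
  have h' : S.fracPow γ x = S.fracPow γ y := h
  exact Subtype.val_injective
    (by rw [← S.negPow_fracPow γ x, ← S.negPow_fracPow γ y, h'])

theorem fracPow_negPow (S : C0Semigroup H) (γ : ℝ) (hγ : Function.Injective (S.negPow γ)) (y : H)
    (hy : S.negPow γ y ∈ (S.fracPow γ).domain) : S.fracPow γ ⟨S.negPow γ y, hy⟩ = y :=
  hγ (S.negPow_fracPow γ ⟨S.negPow γ y, hy⟩)

/-- The space `Ḣ^γ`: the domain of `(-A)^{γ/2}`, with the norm `‖x‖_γ = ‖(-A)^{γ/2} x‖`. -/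
def DotH (S : C0Semigroup H) (γ : ℝ) : Type _ := (S.fracPow (γ / 2)).domain

variable (S : C0Semigroup H) (γ : ℝ)

instance : AddCommGroup (DotH S γ) :=
  inferInstanceAs (AddCommGroup (S.fracPow (γ / 2)).domain)

instance : Module ℂ (DotH S γ) :=
  inferInstanceAs (Module ℂ (S.fracPow (γ / 2)).domain)

/-- The operator `(-A)^{γ/2}` on `Ḣ^γ`. -/
def DotH.pow : DotH S γ →ₗ[ℂ] H := (S.fracPow (γ / 2)).toFun

/-- The inclusion of `Ḣ^γ` into `H`. -/
def DotH.incl : DotH S γ →ₗ[ℂ] H := (S.fracPow (γ / 2)).domain.subtype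

instance : NormedAddCommGroup (DotH S γ) :=
  NormedAddCommGroup.induced (DotH S γ) H (DotH.pow S γ) (S.fracPow_injective (γ / 2))

instance : NormedSpace ℂ (DotH S γ) :=
  NormedSpace.induced ℂ (DotH S γ) H (DotH.pow S γ)

theorem DotH.norm_eq (x : DotH S γ) : ‖x‖ = ‖DotH.pow S γ x‖ := rfl

end FractionalPowers

end C0Semigroup

section Holder

variable (δ : ℝ≥0) (T : ℝ) (E : Type*) [NormedAddCommGroup E] [NormedSpace ℂ E]

/-- The continuous functions `[0, T] → E` with finite `δ`-Hölder seminorm. -/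
def holderSubmodule : Submodule ℂ C(Set.Icc (0 : ℝ) T, E) where
  carrier := {u | MemHolder δ u}
  add_mem' := fun ha hb => MemHolder.add ha hb
  zero_mem' := memHolder_zero
  smul_mem' := fun _ _ ha => MemHolder.smul ha

/-- The Hölder space `C^δ([0, T]; E)`, with the norm
`sup_t ‖u t‖ + sup_{t ≠ s} ‖u t - u s‖ / |t - s|^δ`. For `δ = 0` this is the space of continuous
functions with a norm equivalent to the supremum norm. -/
def HolderSpace : Type _ := holderSubmodule δ T E

instance : AddCommGroup (HolderSpace δ T E) :=
  inferInstanceAs (AddCommGroup (holderSubmodule δ T E))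

instance : Module ℂ (HolderSpace δ T E) :=
  inferInstanceAs (Module ℂ (holderSubmodule δ T E))

variable {δ T E}

/-- The continuous function underlying an element of the Hölder space. -/
def HolderSpace.toCont : HolderSpace δ T E →ₗ[ℂ] C(Set.Icc (0 : ℝ) T, E) :=
  (holderSubmodule δ T E).subtype

theorem HolderSpace.memHolder (u : HolderSpace δ T E) : MemHolder δ (HolderSpace.toCont u) := u.2

instance : Norm (HolderSpace δ T E) where
  norm u := ‖HolderSpace.toCont u‖ + (nnHolderNorm δ (HolderSpace.toCont u) : ℝ)

theorem HolderSpace.norm_eq (u : HolderSpace δ T E) :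
    ‖u‖ = ‖HolderSpace.toCont u‖ + (nnHolderNorm δ (HolderSpace.toCont u) : ℝ) := rfl

theorem HolderSpace.norm_smul_eq (c : ℂ) (u : HolderSpace δ T E) : ‖c • u‖ = ‖c‖ * ‖u‖ := by
  rw [HolderSpace.norm_eq, HolderSpace.norm_eq, map_smul, norm_smul, ContinuousMap.coe_smul,
    u.memHolder.nnHolderNorm_smul c]
  push_cast
  ring

variable (δ T E)

/-- The norm axioms of the Hölder space. -/
theorem HolderSpace.normCore : NormedSpace.Core ℂ (HolderSpace δ T E) where
  norm_nonneg u := by rw [HolderSpace.norm_eq]; positivity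
  norm_smul c u := HolderSpace.norm_smul_eq c u
  norm_triangle u v := by
    have h1 := norm_add_le (HolderSpace.toCont u) (HolderSpace.toCont v)
    have h2 : (nnHolderNorm δ (HolderSpace.toCont u + HolderSpace.toCont v) : ℝ) ≤
        nnHolderNorm δ (HolderSpace.toCont u) + nnHolderNorm δ (HolderSpace.toCont v) :=
      mod_cast u.memHolder.nnHolderNorm_add_le v.memHolder
    rw [HolderSpace.norm_eq, HolderSpace.norm_eq, HolderSpace.norm_eq, map_add]
    linarith
  norm_eq_zero_iff u := by
    rw [HolderSpace.norm_eq]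
    constructor
    · intro h
      have h1 : ‖HolderSpace.toCont u‖ = 0 :=
        le_antisymm (by linarith [(nnHolderNorm δ (HolderSpace.toCont u)).coe_nonneg])
          (norm_nonneg _)
      exact Subtype.val_injective (norm_eq_zero.1 h1)
    · rintro rfl
      rw [map_zero]
      simp [ContinuousMap.coe_zero]

instance : NormedAddCommGroup (HolderSpace δ T E) :=
  NormedAddCommGroup.ofCore (HolderSpace.normCore δ T E)

instance : NormedSpace ℂ (HolderSpace δ T E) :=
  NormedSpace.ofCore (HolderSpace.normCore δ T E)

end Holder

end

/-! Put β = max((θ-ρ)/2, 0) and a = α - β. In the Ḣ norms, R_α is convolution with the kernel K(u) =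
u^(α-1) (-A)^{θ/2} S(u) (-A)^{-ρ/2}, extended by zero to u ≤ 0. Two bounds suffice: ‖K(u)‖ ≤ C
u^(a-1) and ‖K(u+h) - K(u)‖ ≤ C h u^(a-2). For h = t₂ - t₁ > 0 they bound ‖K(t₂-r) - K(t₁-r)‖ by C
h^(a-1) times a fixed profile evaluated at (t₁-r)/h. With q conjugate to p, the profile is in L^q
because 1/p < a ≤ 1, and scaling turns its norm into a multiple of h^(a-1/p). Hölder's inequality
then gives the time regularity (`IsCausalKernel.sub_estimate`). Each of the three conditions implies
β < 1, a > 1/p and δ ≤ a - 1/p.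

The bounds on K come from exponential decay of S and from ‖S'(t)‖ ≤ C/t. For small t the latter is
Cauchy's estimate in the sector; decay extends it to all t. Decay is a spectral fact. A character of
the commutative Banach algebra generated as the bicommutant of S restricts to an exponential e^{μt}
unless it vanishes at S(1), and Re μ ≥ 0 is impossible because the resolvent at μ lies in the
algebra. So S(1) has spectral radius below 1.

Decay makes the integrals for (-A)^{-σ} converge. The Beta integral gives their semigroup law, and
(-A)^{-1} S'(s) = -S(s) gives injectivity. It also lets (-A)^β S(s) be written as -(-A)^{-(1-β)}
S'(s) for 0 < β < 1, of norm at most C s^(-β) (`exists_norm_fracPowMul_le`). -/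

noncomputable section

namespace C0Semigroup

/-! ### Local bounds and Cauchy's estimate for the derivative -/

section Decay

variable {E : Type*} [NormedAddCommGroup E] [NormedSpace ℂ E] {S : C0Semigroup E}

theorem mem_generator_domain {x y : E}
    (h : Tendsto (fun h : ℝ => h⁻¹ • (S.toFun h x - x)) (𝓝[>] 0) (𝓝 y)) :
    ∃ hx : x ∈ S.generator.domain, S.generator ⟨x, hx⟩ = y := by
  have : (x, y) ∈ S.generator.graph := by rw [S.generator_graph]; exact h
  obtain ⟨z, hz, hy⟩ := (LinearPMap.mem_graph_iff _).1 this
  obtain ⟨z, hz'⟩ := z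
  subst hz
  exact ⟨hz', hy⟩

theorem tendsto_generator (x : S.generator.domain) :
    Tendsto (fun h : ℝ => h⁻¹ • (S.toFun h x - (x : E))) (𝓝[>] 0) (𝓝 (S.generator x)) := by
  have : ((x : E), S.generator x) ∈ S.generator.graph := (LinearPMap.mem_graph_iff _).2 ⟨x, rfl, rfl⟩
  rw [S.generator_graph] at this
  exact this

theorem toFun_comm {s t : ℝ} (hs : 0 ≤ s) (ht : 0 ≤ t) :
    S.toFun s * S.toFun t = S.toFun t * S.toFun s := by
  have h1 := S.op_add s t hs ht
  have h2 := S.op_add t s ht hs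
  rw [add_comm] at h1
  exact h1.symm.trans h2

theorem toFun_add {s t : ℝ} (hs : 0 ≤ s) (ht : 0 ≤ t) :
    S.toFun (s + t) = S.toFun s * S.toFun t := S.op_add s t hs ht

/-- A family of operators that converges strongly along a filter is bounded along it. -/
theorem _root_.Filter.Tendsto.eventually_norm_le_of_strong [CompleteSpace E] {ι : Type*}
    {l : Filter ι} [l.IsCountablyGenerated] {V : ι → E →L[ℂ] E} {W : E → E}
    (h : ∀ x, Tendsto (fun z => V z x) l (𝓝 (W x))) : ∃ M : ℝ, ∀ᶠ z in l, ‖V z‖ ≤ M := by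
  by_contra! hcon
  have hfr : ∀ n : ℕ, ∃ᶠ z in l, (n : ℝ) < ‖V z‖ := fun n => by
    exact hcon n
  -- Pointwise bounds hold only eventually, from a point depending on the vector; a sequence along
  -- the filter makes them global, so that Banach–Steinhaus applies.
  obtain ⟨u, hu⟩ := l.exists_antitone_basis
  have : ∀ n : ℕ, ∃ z, z ∈ u n ∧ (n : ℝ) < ‖V z‖ := fun n =>
    ((hfr n).and_eventually (hu.mem n)).exists.imp fun z hz => ⟨hz.2, hz.1⟩
  choose z hz hzV using this
  have hzt : Tendsto z atTop l := hu.tendsto hz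
  obtain ⟨C, hC⟩ := banach_steinhaus (g := fun n => V (z n)) fun x => by
    obtain ⟨C, hC⟩ := ((h x).comp hzt).norm.bddAbove_range
    exact ⟨C, fun n => hC ⟨n, rfl⟩⟩
  obtain ⟨n, hn⟩ := exists_nat_gt C
  linarith [hC n, hzV n]

theorem exists_norm_le_near_zero [CompleteSpace E] (S : C0Semigroup E) :
    ∃ r > 0, ∃ M : ℝ, 1 ≤ M ∧ ∀ t, 0 ≤ t → t ≤ r → ‖S.toFun t‖ ≤ M := by
  obtain ⟨M, hM⟩ := Tendsto.eventually_norm_le_of_strong S.strongly_continuous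
  obtain ⟨r, hr, hr'⟩ := mem_nhdsGT_iff_exists_Ioc_subset.1 hM
  refine ⟨r, hr, max M 1, le_max_right _ _, fun t ht htr => ?_⟩
  rcases ht.eq_or_lt with rfl | ht
  · rw [S.op_zero]; exact ContinuousLinearMap.norm_id_le.trans (le_max_right _ _)
  · exact (hr' ⟨ht, htr⟩).trans (le_max_left _ _)

theorem exists_norm_le_on [CompleteSpace E] (S : C0Semigroup E) (b : ℝ) :
    ∃ M : ℝ, ∀ t, 0 ≤ t → t ≤ b → ‖S.toFun t‖ ≤ M := by
  obtain ⟨r, hr, M, hM1, hM⟩ := S.exists_norm_le_near_zero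
  obtain ⟨n, hn⟩ := exists_nat_gt (b / r)
  rw [div_lt_iff₀ hr] at hn
  suffices ∀ n : ℕ, ∀ t, 0 ≤ t → t ≤ n * r → ‖S.toFun t‖ ≤ M ^ (n + 1) from
    ⟨M ^ (n + 1), fun t ht htb => this n t ht (htb.trans hn.le)⟩
  intro n
  induction n with
  | zero => intro t ht ht'; simpa using hM t ht (ht'.trans (by simpa using hr.le))
  | succ n ih =>
    intro t ht ht'
    rcases le_total t (n * r) with h | h
    · exact (ih t ht h).trans (pow_le_pow_right₀ hM1 (by omega))
    rcases le_total t r with h' | h'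
    · calc _ ≤ M := hM t ht h'
        _ ≤ _ := le_self_pow₀ hM1 (by omega)
    have : t = (t - r) + r := by ring
    rw [this, toFun_add (by linarith) hr.le]
    refine (norm_mul_le _ _).trans ?_
    rw [pow_succ]
    push_cast at ht'
    exact mul_le_mul (ih _ (by linarith) (by linarith)) (hM r hr.le le_rfl) (norm_nonneg _)
      (by positivity)

/-- The sector is a neighbourhood of 1 and is invariant under positive scaling. -/
theorem _root_.exists_ball_subset_openSector {φ : ℝ} (hφ : 0 < φ) :
    ∃ c > 0, ∀ t : ℝ, 0 < t → Metric.ball (t : ℂ) (c * t) ⊆ openSector φ := by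
  have h1 : ∀ᶠ w in 𝓝 (1 : ℂ), w ≠ 0 ∧ |w.arg| < φ := by
    refine (eventually_ne_nhds one_ne_zero).and ?_
    have : ContinuousAt (fun w : ℂ => |w.arg|) 1 :=
      (Complex.continuousAt_arg (by simp)).abs
    exact this.eventually_lt continuousAt_const (by simpa using hφ)
  obtain ⟨c, hc, h⟩ := Metric.eventually_nhds_iff.1 h1
  refine ⟨c, hc, fun t ht z hz => ?_⟩
  have ht' : (t : ℂ) ≠ 0 := by exact_mod_cast ht.ne'
  have hz' : z = (t : ℂ) * (z / t) := by field_simp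
  have := h (y := z / t) (by
    rw [Metric.mem_ball, dist_eq_norm] at hz
    have h3 : z / t - 1 = (z - t) / t := by field_simp
    rw [dist_eq_norm, h3, norm_div, Complex.norm_real, Real.norm_of_nonneg ht.le, div_lt_iff₀ ht]
    exact hz)
  rw [hz']
  refine ⟨mul_ne_zero ht' this.1, ?_⟩
  rw [Complex.arg_real_mul _ ht]
  exact this.2

theorem _root_.ofReal_mem_openSector {φ : ℝ} (hφ : 0 < φ) {t : ℝ} (ht : 0 < t) :
    openSector φ ∈ 𝓝 (t : ℂ) := by
  obtain ⟨c, hc, h⟩ := exists_ball_subset_openSector hφ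
  exact mem_of_superset (Metric.ball_mem_nhds _ (by positivity)) (h t ht)

theorem hasDerivAt_of_extension {V : ℂ → E →L[ℂ] E} {φ : ℝ} (hφ : 0 < φ)
    (hV : ∀ t : ℝ, 0 ≤ t → V t = S.toFun t) (hd : DifferentiableOn ℂ V (openSector φ))
    {t : ℝ} (ht : 0 < t) : HasDerivAt S.toFun (deriv V t) t := by
  have h1 : HasDerivAt V (deriv V t) (t : ℂ) :=
    (hd.differentiableAt (ofReal_mem_openSector hφ ht)).hasDerivAt
  have h2 : HasDerivAt (fun s : ℝ => V s) (deriv V t) t := by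
    have h3 : HasDerivAt (fun s : ℝ => V s) ((1 : ℂ) • deriv V t) t :=
      h1.scomp t (Complex.ofRealCLM.hasDerivAt)
    rwa [one_smul] at h3
  refine h2.congr_of_eventuallyEq ?_
  filter_upwards [Ioi_mem_nhds ht] with s hs
  exact (hV s (le_of_lt hs)).symm

theorem IsAnalytic.differentiableAt (hS : S.IsAnalytic) {t : ℝ} (ht : 0 < t) :
    DifferentiableAt ℝ S.toFun t := by
  obtain ⟨φ, hφ, -, V, hV, hd, -, -⟩ := hS
  exact (hasDerivAt_of_extension hφ hV hd ht).differentiableAt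

/-- Cauchy's estimate on a circle about t of radius proportional to t: it stays in the sector and,
for small t, in the region where the holomorphic extension is bounded. -/
theorem IsAnalytic.exists_norm_deriv_le_near [CompleteSpace E] (hS : S.IsAnalytic) :
    ∃ r > 0, ∃ C : ℝ, ∀ t, 0 < t → t ≤ r → ‖deriv S.toFun t‖ ≤ C / t := by
  obtain ⟨φ, hφ, -, V, hV, hd, -, hlim⟩ := hS
  obtain ⟨c, hc, hball⟩ := exists_ball_subset_openSector hφ
  obtain ⟨M, hM⟩ := Tendsto.eventually_norm_le_of_strong hlim
  obtain ⟨ε, hε, hM⟩ := Metric.eventually_nhds_iff.1 (eventually_nhdsWithin_iff.1 hM)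
  -- Points of the circle of radius c t / 2 about t have modulus at most (1 + c/2) t ≤ ε/2.
  refine ⟨ε / (2 + c), by positivity, M / (c / 2), fun t ht htr => ?_⟩
  rw [le_div_iff₀ (by positivity)] at htr
  have hsub : Metric.closedBall (t : ℂ) (c / 2 * t) ⊆ openSector φ :=
    (Metric.closedBall_subset_ball (by nlinarith)).trans (hball t ht)
  rw [(hasDerivAt_of_extension hφ hV hd ht).deriv, div_div]
  refine Complex.norm_deriv_le_of_forall_mem_sphere_norm_le (by positivity) ?_ fun z hz => ?_
  · refine DifferentiableOn.diffContOnCl (hd.mono (subset_trans ?_ hsub))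
    exact Metric.closure_ball_subset_closedBall
  · refine hM ?_ (hsub (Metric.sphere_subset_closedBall hz))
    rw [mem_sphere_iff_norm] at hz
    rw [dist_zero_right]
    have h4 : ‖z‖ ≤ ‖z - t‖ + ‖(t : ℂ)‖ := by
      simpa using norm_add_le (z - t) (t : ℂ)
    rw [Complex.norm_real, Real.norm_of_nonneg ht.le, hz] at h4
    nlinarith

/-! ### Resolvents, characters and exponential decay -/

/-- On the range of the semigroup, the derivative is the generator; the resolvent inverts it. -/
theorem resolvent_comp_deriv {t : ℝ} (ht : 0 < t)
    (hd : DifferentiableAt ℝ S.toFun t) {z : ℂ} {R : E →L[ℂ] E}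
    (hR : ∀ x : S.generator.domain, R (z • (x : E) - S.generator x) = x) :
    R * (z • S.toFun t - deriv S.toFun t) = S.toFun t := by
  ext x
  have h1 : Tendsto (fun h : ℝ => h⁻¹ • (S.toFun h (S.toFun t x) - S.toFun t x)) (𝓝[>] 0)
      (𝓝 (deriv S.toFun t x)) := by
    have h2 := hd.hasDerivAt.tendsto_slope_zero_right
    have h3 := ((ContinuousLinearMap.apply ℂ E x).continuous.tendsto _).comp h2
    refine h3.congr' ?_
    filter_upwards [self_mem_nhdsWithin] with h hh
    have hh : 0 < h := hh
    rw [Function.comp_apply, add_comm t h, S.op_add h t hh.le ht.le]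
    simp
  obtain ⟨hx, hA⟩ := mem_generator_domain h1
  have := hR ⟨_, hx⟩
  rw [hA] at this
  simpa using this

/-- The resolvent commutes with every operator that commutes with the semigroup. -/
theorem resolvent_comm {z : ℂ} {R Q : E →L[ℂ] E}
    (hR : ∀ x : S.generator.domain, R (z • (x : E) - S.generator x) = x)
    (hR' : ∀ x : E, ∃ h : R x ∈ S.generator.domain, z • R x - S.generator ⟨R x, h⟩ = x)
    (hQ : ∀ t, 0 ≤ t → Q * S.toFun t = S.toFun t * Q) : Q * R = R * Q := by
  ext x
  obtain ⟨h, hx⟩ := hR' x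
  have h1 := ((Q.continuous.tendsto _).comp (tendsto_generator ⟨R x, h⟩))
  have h2 : Tendsto (fun h : ℝ => h⁻¹ • (S.toFun h (Q (R x)) - Q (R x))) (𝓝[>] 0)
      (𝓝 (Q (S.generator ⟨R x, h⟩))) := by
    refine h1.congr' ?_
    filter_upwards [self_mem_nhdsWithin] with h hh
    have hh : 0 < h := hh
    have := DFunLike.congr_fun (hQ h hh.le) (R x)
    simp only [mul_apply_eq_comp] at this
    simp [this]
  obtain ⟨hx', hA⟩ := mem_generator_domain h2
  have h3 := hR ⟨_, hx'⟩
  rw [hA] at h3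
  have h4 : z • Q (R x) - Q (S.generator ⟨R x, h⟩) = Q x := by
    conv_rhs => rw [← hx]
    simp
  simp only [h4] at h3
  exact h3.symm

/-- A multiplicative differentiable function on `(0, ∞)` that does not vanish at `1` is an
exponential. -/
theorem _root_.exists_eq_exp_of_mul {g : ℝ → ℂ} (hd : ∀ t, 0 < t → DifferentiableAt ℝ g t)
    (hg : ∀ s t, 0 < s → 0 < t → g (s + t) = g s * g t) (h1 : g 1 ≠ 0) :
    ∃ μ : ℂ, ∀ t, 0 < t → g t = Complex.exp (μ * t) ∧ deriv g t = μ * g t := by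
  have hshift : ∀ s t, 0 < s → 0 < t → deriv g (s + t) = deriv g s * g t := by
    intro s t hs ht
    have h2 : HasDerivAt (fun x => g (x + t)) (deriv g (s + t)) s :=
      (hd (s + t) (by positivity)).hasDerivAt.comp_add_const s t
    have h3 : HasDerivAt (fun x => g x * g t) (deriv g s * g t) s :=
      (hd s hs).hasDerivAt.mul_const _
    refine (h2.congr_of_eventuallyEq ?_).unique h3
    filter_upwards [Ioi_mem_nhds hs] with x hx
    exact (hg x t hx ht).symm
  -- Exchanging the two arguments in g'(s + t) = g'(s) g(t) gives g'(t) g(1) = g'(1) g(t), which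
  -- forces this rate.
  set μ := deriv g 1 / g 1 with hμ
  have hder : ∀ t, 0 < t → deriv g t = μ * g t := by
    intro t ht
    have h4 := hshift 1 t one_pos ht
    rw [add_comm, hshift t 1 ht one_pos] at h4
    rw [hμ]
    field_simp
    exact h4
  refine ⟨μ, fun t ht => ⟨?_, hder t ht⟩⟩
  have hE : ∀ x : ℝ, HasDerivAt (fun x : ℝ => Complex.exp (-(μ * x))) (Complex.exp (-(μ * x)) * -μ) x := by
    intro x
    have h5 : HasDerivAt (fun x : ℝ => -(μ * (x : ℂ))) (-μ) x := by
      have h6 : HasDerivAt (fun x : ℝ => -(μ * (x : ℂ))) (-(μ * 1)) x :=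
        ((Complex.ofRealCLM.hasDerivAt (x := x)).const_mul μ).neg
      rwa [mul_one] at h6
    exact h5.cexp
  have hconst : ∀ s ∈ Set.Ioi (0 : ℝ), ∀ t ∈ Set.Ioi (0 : ℝ),
      Complex.exp (-(μ * s)) * g s = Complex.exp (-(μ * t)) * g t := by
    have hF : ∀ x ∈ Set.Ioi (0 : ℝ), HasDerivAt (fun x : ℝ => Complex.exp (-(μ * x)) * g x) 0 x := by
      intro x hx
      have h7 := (hE x).mul (hd x hx).hasDerivAt
      rw [hder x hx] at h7
      have h8 : Complex.exp (-(μ * x)) * -μ * g x + Complex.exp (-(μ * x)) * (μ * g x) = 0 := by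
        ring
      rw [h8] at h7
      exact h7
    intro s hs t ht
    refine (convex_Ioi (0 : ℝ)).is_const_of_fderivWithin_eq_zero (𝕜 := ℝ)
      (f := fun x : ℝ => Complex.exp (-(μ * x)) * g x)
      (fun x hx => (hF x hx).differentiableAt.differentiableWithinAt) (fun x hx => ?_) hs ht
    rw [fderivWithin_of_isOpen isOpen_Ioi hx]
    ext
    simpa using (hF x hx).deriv
  have h6 := hconst 1 (by simp) t ht
  -- The constant e^{-μt} g(t) is nonzero, and its value at 1 + t is the product of its values at 1
  -- and t; hence it is 1.
  have h7 := hconst 1 (by simp) (1 + t) (by simp; positivity)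
  rw [hg 1 t one_pos ht] at h7
  have h8 : Complex.exp (-(μ * ((1 + t : ℝ) : ℂ))) =
      Complex.exp (-(μ * ((1 : ℝ) : ℂ))) * Complex.exp (-(μ * t)) := by
    rw [← Complex.exp_add]; congr 1; push_cast; ring
  rw [h8] at h7
  have h9 : Complex.exp (-(μ * ((1 : ℝ) : ℂ))) * g 1 ≠ 0 := mul_ne_zero (Complex.exp_ne_zero _) h1
  have h10 : Complex.exp (-(μ * t)) * g t = 1 := by
    refine mul_left_cancel₀ h9 ?_
    linear_combination -h7
  have h11 : Complex.exp (μ * t) * Complex.exp (-(μ * t)) = 1 := by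
    rw [← Complex.exp_add]; simp
  calc g t = (Complex.exp (μ * t) * Complex.exp (-(μ * t))) * g t := by rw [h11, one_mul]
    _ = Complex.exp (μ * t) := by rw [mul_assoc, h10, mul_one]

/-- The bicommutant of a semigroup. -/
def bicommutant (S : C0Semigroup E) : Subalgebra ℂ (E →L[ℂ] E) :=
  Subalgebra.centralizer ℂ (Subalgebra.centralizer ℂ (S.toFun '' Set.Ici 0) : Set (E →L[ℂ] E))

theorem mem_bicommutant {Q : E →L[ℂ] E} : Q ∈ S.bicommutant ↔
    ∀ P : E →L[ℂ] E, (∀ t, 0 ≤ t → P * S.toFun t = S.toFun t * P) → P * Q = Q * P := by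
  simp only [bicommutant, Subalgebra.mem_centralizer_iff, SetLike.mem_coe]
  refine forall_congr' fun P => ⟨fun h h' => h ?_, fun h h' => h fun t ht => ?_⟩
  · rintro _ ⟨t, ht, rfl⟩; exact (h' t ht).symm
  · exact (h' _ ⟨t, ht, rfl⟩).symm

theorem toFun_mem_bicommutant {t : ℝ} (ht : 0 ≤ t) : S.toFun t ∈ S.bicommutant :=
  mem_bicommutant.2 fun _ h => h t ht

/-- The operators of the semigroup commute with each other, so they lie in their own commutant, and
the bicommutant is therefore contained in the commutant. -/
theorem bicommutant_mul_comm {P Q : E →L[ℂ] E} (hP : P ∈ S.bicommutant) (hQ : Q ∈ S.bicommutant) :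
    P * Q = Q * P :=
  mem_bicommutant.1 hQ P fun _ ht => (mem_bicommutant.1 hP _ fun _ hs => toFun_comm ht hs).symm

instance [CompleteSpace E] : CompleteSpace S.bicommutant :=
  (Set.isClosed_centralizer
    (Subalgebra.centralizer ℂ (S.toFun '' Set.Ici 0) : Set (E →L[ℂ] E))).completeSpace_coe

instance : NormedCommRing S.bicommutant :=
  { (inferInstance : NormedRing S.bicommutant) with
    mul_comm := fun a b => Subtype.ext (bicommutant_mul_comm a.2 b.2) }

/-- No character of the bicommutant takes a value of modulus at least one at `S 1`. -/
theorem IsAnalytic.norm_character_lt_one [CompleteSpace E] (hS : S.IsAnalytic)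
    (hA : ∀ z : ℂ, 0 ≤ z.re → z ∈ S.generator.resolventSet)
    (χ : WeakDual.characterSpace ℂ S.bicommutant) :
    ‖χ ⟨S.toFun 1, toFun_mem_bicommutant zero_le_one⟩‖ < 1 := by
  by_contra! hcon
  -- Truncation at 0 gives a function on all of ℝ with values in the algebra, as derivatives
  -- require.
  let s : ℝ → S.bicommutant := fun t => ⟨S.toFun (max t 0), toFun_mem_bicommutant (le_max_right _ _)⟩
  have hs1 : s 1 = ⟨S.toFun 1, toFun_mem_bicommutant zero_le_one⟩ := by
    apply Subtype.ext; simp [s]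
  rw [← hs1] at hcon
  have hst : ∀ t, 0 < t → (s t : E →L[ℂ] E) = S.toFun t := fun t ht => by
    simp [s, max_eq_left ht.le]
  have hsd : ∀ t, 0 < t → ∃ D : S.bicommutant, (D : E →L[ℂ] E) = deriv S.toFun t ∧
      HasDerivAt s D t := by
    intro t ht
    have hd := (hS.differentiableAt ht).hasDerivAt
    have hd' : HasDerivAt (fun x => (s x : E →L[ℂ] E)) (deriv S.toFun t) t := by
      refine hd.congr_of_eventuallyEq ?_
      filter_upwards [Ioi_mem_nhds ht] with x hx using hst x hx
    have hmem : deriv S.toFun t ∈ S.bicommutant := by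
      refine mem_bicommutant.2 fun P hP => ?_
      refine ((hd.const_mul P).congr_of_eventuallyEq ?_).unique (hd.mul_const P)
      filter_upwards [Ioi_mem_nhds ht] with x hx using (hP x (le_of_lt hx)).symm
    refine ⟨⟨_, hmem⟩, rfl, ?_⟩
    rw [hasDerivAt_iff_tendsto_slope] at hd' ⊢
    rw [tendsto_subtype_rng]
    refine hd'.congr fun x => ?_
    simp [slope]
  have hgd : ∀ t, 0 < t → ∃ D : S.bicommutant, (D : E →L[ℂ] E) = deriv S.toFun t ∧
      HasDerivAt (fun x => χ (s x)) (χ D) t := by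
    intro t ht
    obtain ⟨D, hD, hD'⟩ := hsd t ht
    refine ⟨D, hD, ?_⟩
    exact ((WeakDual.CharacterSpace.toCLM χ).restrictScalars ℝ).hasFDerivAt.comp_hasDerivAt t hD'
  obtain ⟨μ, hμ⟩ := exists_eq_exp_of_mul (g := fun t => χ (s t))
    (fun t ht => (hgd t ht).choose_spec.2.differentiableAt)
    (fun a b ha hb => by
      rw [← map_mul]
      congr 1
      apply Subtype.ext
      rw [MulMemClass.coe_mul, hst _ ha, hst _ hb, hst _ (by positivity), toFun_add ha.le hb.le])
    (fun h => by rw [h, norm_zero] at hcon; linarith)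
  have hre : 0 ≤ μ.re := by
    rw [(hμ 1 one_pos).1, Complex.norm_exp] at hcon
    simpa using Real.one_le_exp_iff.1 hcon
  obtain ⟨R, hR1, hR2⟩ := hA μ hre
  -- This is why the bicommutant is used: it contains the resolvents, so χ can be evaluated on them.
  have hRmem : R ∈ S.bicommutant := mem_bicommutant.2 fun P hP => resolvent_comm hR2 hR1 hP
  obtain ⟨D, hD, hD'⟩ := hgd 1 one_pos
  have hid : (⟨R, hRmem⟩ : S.bicommutant) * (μ • s 1 - D) = s 1 := by
    apply Subtype.ext
    have := resolvent_comp_deriv one_pos (hS.differentiableAt one_pos) hR2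
    simpa [hst 1 one_pos, hD] using this
  -- Applying χ to R (μ S(1) - S'(1)) = S(1) now gives χ(S(1)) = 0, against the assumed modulus at
  -- least 1.
  have h0 : χ (μ • s 1 - D) = 0 := by
    rw [map_sub, map_smul, ← hD'.deriv, (hμ 1 one_pos).2, smul_eq_mul, sub_self]
  have := congrArg χ hid
  rw [map_mul, h0, mul_zero] at this
  rw [← this, norm_zero] at hcon
  linarith

/-- By Gelfand theory the spectrum of S(1) in the bicommutant consists of character values, and the
spectral radius is attained there, so it is below 1. Gelfand's formula then applies to the powers
S(1)^n = S(n). -/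
theorem IsAnalytic.exists_norm_lt_one [CompleteSpace E] (hS : S.IsAnalytic)
    (hA : ∀ z : ℂ, 0 ≤ z.re → z ∈ S.generator.resolventSet) :
    ∃ n : ℕ, 0 < n ∧ ‖S.toFun n‖ < 1 := by
  -- In the zero algebra the spectrum is empty, so this case is separate.
  rcases subsingleton_or_nontrivial E with hE | hE
  · refine ⟨1, one_pos, ?_⟩
    rw [Subsingleton.elim (S.toFun _) 0, norm_zero]; exact one_pos
  let a : S.bicommutant := ⟨S.toFun 1, toFun_mem_bicommutant zero_le_one⟩
  obtain ⟨z, hz, hzr⟩ := spectrum.exists_nnnorm_eq_spectralRadius a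
  obtain ⟨χ, hχ⟩ := WeakDual.CharacterSpace.mem_spectrum_iff_exists.1 hz
  have hr : spectralRadius ℂ a < 1 := by
    rw [← hzr, ← hχ]
    exact_mod_cast hS.norm_character_lt_one hA χ
  have hlim := spectrum.pow_nnnorm_pow_one_div_tendsto_nhds_spectralRadius a
  obtain ⟨n, hn, hn0⟩ := ((hlim.eventually_lt_const hr).and (eventually_gt_atTop 0)).exists
  refine ⟨n, hn0, ?_⟩
  have hpow : ∀ n : ℕ, S.toFun n = S.toFun 1 ^ n := by
    intro n
    induction n with
    | zero => rw [Nat.cast_zero, pow_zero]; exact S.op_zero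
    | succ n ih => rw [pow_succ, ← ih, ← toFun_add n.cast_nonneg zero_le_one]; push_cast; rfl
  by_contra! hcon
  refine hn.not_ge (ENNReal.one_le_rpow ?_ (by positivity))
  have : ‖a ^ n‖ = ‖S.toFun n‖ := by rw [hpow]; rfl
  rw [← this] at hcon
  exact_mod_cast hcon

/-- An analytic semigroup whose generator has no spectrum in the closed right half-plane decays
exponentially. -/
theorem IsAnalytic.exists_norm_le_exp [CompleteSpace E] (hS : S.IsAnalytic)
    (hA : ∀ z : ℂ, 0 ≤ z.re → z ∈ S.generator.resolventSet) :
    ∃ ω > 0, ∃ M > 0, ∀ t, 0 ≤ t → ‖S.toFun t‖ ≤ M * Real.exp (-ω * t) := by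
  obtain ⟨n, hn, hlt⟩ := hS.exists_norm_lt_one hA
  obtain ⟨c, hc, hc1⟩ := exists_between hlt
  have hc0 : 0 < c := (norm_nonneg _).trans_lt hc
  obtain ⟨M, hM⟩ := S.exists_norm_le_on n
  have hM0 : 0 ≤ M := (norm_nonneg _).trans (hM 0 le_rfl n.cast_nonneg)
  have hn' : (0 : ℝ) < n := by exact_mod_cast hn
  -- Chosen so that e^{-ωn} = c. Taking c strictly above ‖S(n)‖ keeps it positive even if S(n) = 0.
  set ω := -Real.log c / n with hω
  have hω0 : 0 < ω := div_pos (neg_pos.2 (Real.log_neg hc0 hc1)) hn'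
  have hcexp : Real.exp (-ω * n) = c := by
    rw [hω, neg_mul, div_mul_cancel₀ _ hn'.ne', neg_neg, Real.exp_log hc0]
  -- The factor e^{ωn} pays for the remainder of t modulo n, on which there is no decay.
  refine ⟨ω, hω0, (M + 1) * Real.exp (ω * n), by positivity, ?_⟩
  have key : ∀ k : ℕ, ∀ t : ℝ, 0 ≤ t → t ≤ n → ‖S.toFun (k * n + t)‖ ≤ c ^ k * M := by
    intro k
    induction k with
    | zero => intro t ht htn; simpa using hM t ht htn
    | succ k ih =>
      intro t ht htn
      have : ((k + 1 : ℕ) : ℝ) * n + t = n + (k * n + t) := by push_cast; ring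
      rw [this, toFun_add hn'.le (by positivity), pow_succ']
      refine (norm_mul_le _ _).trans ?_
      rw [mul_assoc]
      exact mul_le_mul hc.le (ih t ht htn) (norm_nonneg _) hc0.le
  intro t ht
  set k := ⌊t / n⌋₊
  have hk1 : k * n ≤ t := by
    rw [← le_div_iff₀ hn']; exact Nat.floor_le (by positivity)
  have hk2 : t < (k + 1) * n := by
    rw [← div_lt_iff₀ hn']; exact Nat.lt_floor_add_one _
  have h1 := key k (t - k * n) (by linarith) (by linarith)
  rw [add_sub_cancel] at h1
  have h2 : c ^ k ≤ Real.exp (ω * n) * Real.exp (-ω * t) := by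
    rw [← hcexp, ← Real.exp_nat_mul, ← Real.exp_add]
    apply Real.exp_le_exp.2
    nlinarith
  calc _ ≤ c ^ k * M := h1
    _ ≤ (Real.exp (ω * n) * Real.exp (-ω * t)) * (M + 1) := by gcongr; linarith
    _ = _ := by ring

theorem IsAnalytic.deriv_add (hS : S.IsAnalytic) {s t : ℝ} (hs : 0 < s) (ht : 0 ≤ t) :
    deriv S.toFun (s + t) = S.toFun t * deriv S.toFun s := by
  have h2 : HasDerivAt (fun x => S.toFun (x + t)) (deriv S.toFun (s + t)) s :=
    (hS.differentiableAt (by positivity)).hasDerivAt.comp_add_const s t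
  refine (h2.congr_of_eventuallyEq ?_).unique ((hS.differentiableAt hs).hasDerivAt.const_mul _)
  filter_upwards [Ioi_mem_nhds hs] with x hx
  rw [toFun_comm ht (le_of_lt hx), toFun_add (le_of_lt hx) ht]

theorem IsAnalytic.deriv_comm (hS : S.IsAnalytic) {s t : ℝ} (hs : 0 < s) (ht : 0 ≤ t) :
    deriv S.toFun s * S.toFun t = S.toFun t * deriv S.toFun s := by
  have hd := (hS.differentiableAt hs).hasDerivAt
  refine ((hd.mul_const _).congr_of_eventuallyEq ?_).unique (hd.const_mul _)
  filter_upwards [Ioi_mem_nhds hs] with x hx using (toFun_comm (le_of_lt hx) ht).symm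

/-- Beyond the range of Cauchy's estimate, S'(t) = S(t-r) S'(r) decays exponentially, which is
faster than 1/t. -/
theorem IsAnalytic.exists_norm_deriv_le [CompleteSpace E] (hS : S.IsAnalytic)
    (hA : ∀ z : ℂ, 0 ≤ z.re → z ∈ S.generator.resolventSet) :
    ∃ C > 0, ∀ t, 0 < t → ‖deriv S.toFun t‖ ≤ C / t := by
  obtain ⟨r, hr, C, hC⟩ := hS.exists_norm_deriv_le_near
  obtain ⟨ω, hω, M, hM, hexp⟩ := hS.exists_norm_le_exp hA
  have hC0 : 0 ≤ C := by
    have := (norm_nonneg _).trans (hC r hr le_rfl)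
    rwa [le_div_iff₀ hr, zero_mul] at this
  refine ⟨C + M * (C / r) * (r + 1 / ω) + 1, by positivity, fun t ht => ?_⟩
  rcases le_total t r with h | h
  · refine (hC t ht h).trans ?_
    gcongr
    have : 0 ≤ M * (C / r) * (r + 1 / ω) := by positivity
    linarith
  · have h1 := hS.deriv_add hr (sub_nonneg.2 h)
    rw [add_sub_cancel] at h1
    rw [h1, le_div_iff₀ ht]
    -- Write t = r + (t - r) and use x e^{-x} ≤ 1 with x = ω(t - r).
    have h2 : t * Real.exp (-ω * (t - r)) ≤ r + 1 / ω := by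
      have h3 : Real.exp (-ω * (t - r)) ≤ 1 := Real.exp_le_one_iff.2 (by nlinarith)
      have h4 : ω * (t - r) * Real.exp (-ω * (t - r)) ≤ 1 := by
        have h5 : ω * (t - r) ≤ Real.exp (ω * (t - r)) := by
          linarith [Real.add_one_le_exp (ω * (t - r))]
        calc _ ≤ Real.exp (ω * (t - r)) * Real.exp (-ω * (t - r)) := by gcongr
          _ = 1 := by rw [← Real.exp_add]; simp
      have h6 : (t - r) * Real.exp (-ω * (t - r)) ≤ 1 / ω := by
        rw [le_div_iff₀ hω]; linarith
      nlinarith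
    calc _ ≤ ‖S.toFun (t - r)‖ * ‖deriv S.toFun r‖ * t := by gcongr; exact norm_mul_le _ _
      _ ≤ (M * Real.exp (-ω * (t - r))) * (C / r) * t := by
        gcongr
        · exact hexp _ (sub_nonneg.2 h)
        · exact hC r hr le_rfl
      _ = M * (C / r) * (t * Real.exp (-ω * (t - r))) := by ring
      _ ≤ M * (C / r) * (r + 1 / ω) := by gcongr
      _ ≤ _ := by linarith

end Decay

end C0Semigroup

/-! ### Negative fractional powers of the generator -/

/-- The real Beta integral over `[0, x]`. -/
theorem integral_rpow_mul_sub_rpow {a b x : ℝ} (ha : 0 < a) (hb : 0 < b) (hx : 0 < x) :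
    ∫ t in (0 : ℝ)..x, t ^ (a - 1) * (x - t) ^ (b - 1) =
      Real.Gamma a * Real.Gamma b / Real.Gamma (a + b) * x ^ (a + b - 1) := by
  have h1 := Complex.betaIntegral_scaled a b hx
  rw [Complex.betaIntegral_eq_Gamma_mul_div _ _ (by simpa using ha) (by simpa using hb)] at h1
  apply Complex.ofReal_injective
  rw [← intervalIntegral.integral_ofReal]
  have h2 : ∫ t in (0 : ℝ)..x, ((t ^ (a - 1) * (x - t) ^ (b - 1) : ℝ) : ℂ) =
      ∫ t in (0 : ℝ)..x, (t : ℂ) ^ ((a : ℂ) - 1) * ((x : ℂ) - t) ^ ((b : ℂ) - 1) := by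
    refine intervalIntegral.integral_congr fun t ht => ?_
    rw [Set.uIcc_of_le hx.le] at ht
    rw [Complex.ofReal_mul, Complex.ofReal_cpow ht.1, Complex.ofReal_cpow (sub_nonneg.2 ht.2)]
    push_cast
    rfl
  rw [h2, h1]
  push_cast [Complex.ofReal_cpow hx.le, ← Complex.Gamma_ofReal]
  ring

namespace C0Semigroup

variable {H : Type*} [NormedAddCommGroup H] [InnerProductSpace ℂ H] [CompleteSpace H]
  {S : C0Semigroup H}

theorem IsAnalytic.continuousOn (hS : S.IsAnalytic) : ContinuousOn S.toFun (Set.Ioi 0) :=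
  fun _ ht => (hS.differentiableAt ht).continuousAt.continuousWithinAt

theorem IsAnalytic.continuousOn_deriv (hS : S.IsAnalytic) :
    ContinuousOn (deriv S.toFun) (Set.Ioi 0) := by
  intro t ht
  have ht : 0 < t := ht
  refine ContinuousAt.continuousWithinAt ?_
  have h1 : ContinuousAt (fun x => S.toFun (x - t / 2) * deriv S.toFun (t / 2)) t := by
    refine ContinuousAt.mul ?_ continuousAt_const
    have h2 : ContinuousAt S.toFun (t - t / 2) :=
      (hS.differentiableAt (by linarith)).continuousAt
    exact ContinuousAt.comp (f := fun x => x - t / 2) h2 (by fun_prop)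
  refine h1.congr ?_
  filter_upwards [Ioi_mem_nhds (show t / 2 < t by linarith)] with x hx
  have hx : t / 2 < x := hx
  rw [← hS.deriv_add (by positivity) (by linarith), add_sub_cancel]

theorem IsAnalytic.integrableOn_rpow_smul (hS : S.IsAnalytic)
    (hA : ∀ z : ℂ, 0 ≤ z.re → z ∈ S.generator.resolventSet) {γ : ℝ} (hγ : 0 < γ) :
    IntegrableOn (fun t : ℝ => t ^ (γ - 1) • S.toFun t) (Set.Ioi 0) := by
  obtain ⟨ω, hω, M, hM, hexp⟩ := hS.exists_norm_le_exp hA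
  have h1 := (integrableOn_rpow_mul_exp_neg_mul_rpow (s := γ - 1) (by linarith) one_pos hω).const_mul M
  refine h1.mono' ?_ ?_
  · refine ContinuousOn.aestronglyMeasurable ?_ measurableSet_Ioi
    refine ContinuousOn.smul (f := fun t : ℝ => t ^ (γ - 1)) (g := S.toFun) (fun t ht => ?_) hS.continuousOn
    exact (Real.continuousAt_rpow_const t _ (Or.inl (ne_of_gt ht))).continuousWithinAt
  · filter_upwards [ae_restrict_mem measurableSet_Ioi] with t ht
    have ht : 0 < t := ht
    rw [norm_smul, Real.norm_of_nonneg (by positivity)]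
    calc _ ≤ t ^ (γ - 1) * (M * Real.exp (-ω * t)) := by gcongr; exact hexp t ht.le
      _ = _ := by rw [Real.rpow_one]; ring

omit [CompleteSpace H] in
theorem negPow_of_pos {γ : ℝ} (hγ : 0 < γ) :
    S.negPow γ = (Real.Gamma γ)⁻¹ • ∫ t in Set.Ioi (0 : ℝ), t ^ (γ - 1) • S.toFun t := by
  rw [negPow, if_neg hγ.ne']

omit [CompleteSpace H] in
theorem negPow_zero : S.negPow 0 = 1 := if_pos rfl

theorem IsAnalytic.negPow_comm (hS : S.IsAnalytic)
    (hA : ∀ z : ℂ, 0 ≤ z.re → z ∈ S.generator.resolventSet) {γ : ℝ} (hγ : 0 ≤ γ) {Q : H →L[ℂ] H}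
    (hQ : ∀ t, 0 < t → Q * S.toFun t = S.toFun t * Q) : Q * S.negPow γ = S.negPow γ * Q := by
  rcases hγ.eq_or_lt with rfl | hγ
  · rw [negPow_zero, mul_one, one_mul]
  have hi := hS.integrableOn_rpow_smul hA hγ
  rw [negPow_of_pos hγ, mul_smul_comm, smul_mul_assoc, ← integral_const_mul_of_integrable hi,
    ← integral_mul_const_of_integrable hi]
  congr 1
  refine setIntegral_congr_fun measurableSet_Ioi fun t ht => ?_
  rw [mul_smul_comm, smul_mul_assoc, hQ t ht]

/-- The product of the two integrals is the integral of a convolution. There S(t) S(x-t) = S(x)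
leaves the scalar Beta integral, whose Gamma factors are those of the normalisation. -/
theorem IsAnalytic.negPow_mul (hS : S.IsAnalytic)
    (hA : ∀ z : ℂ, 0 ≤ z.re → z ∈ S.generator.resolventSet) {a b : ℝ} (ha : 0 ≤ a) (hb : 0 ≤ b) :
    S.negPow a * S.negPow b = S.negPow (a + b) := by
  rcases ha.eq_or_lt with rfl | ha
  · rw [negPow_zero, one_mul, zero_add]
  rcases hb.eq_or_lt with rfl | hb
  · rw [negPow_zero, mul_one, add_zero]
  have hconv := integral_posConvolution (hS.integrableOn_rpow_smul hA ha)
    (hS.integrableOn_rpow_smul hA hb) (ContinuousLinearMap.mul ℝ (H →L[ℂ] H))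
  have hinner : ∀ x ∈ Set.Ioi (0 : ℝ), (∫ t in (0 : ℝ)..x,
      ContinuousLinearMap.mul ℝ (H →L[ℂ] H) (t ^ (a - 1) • S.toFun t)
        ((x - t) ^ (b - 1) • S.toFun (x - t))) =
      (Real.Gamma a * Real.Gamma b / Real.Gamma (a + b)) • (x ^ (a + b - 1) • S.toFun x) := by
    intro x hx
    rw [smul_smul, ← integral_rpow_mul_sub_rpow ha hb hx, ← intervalIntegral.integral_smul_const]
    refine intervalIntegral.integral_congr fun t ht => ?_
    rw [Set.uIcc_of_le (le_of_lt hx)] at ht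
    simp only [ContinuousLinearMap.mul_apply']
    rw [smul_mul_smul_comm, ← toFun_add ht.1 (sub_nonneg.2 ht.2), add_sub_cancel]
  rw [setIntegral_congr_fun measurableSet_Ioi hinner, integral_smul,
    ContinuousLinearMap.mul_apply'] at hconv
  have hΓa := (Real.Gamma_pos_of_pos ha).ne'
  have hΓb := (Real.Gamma_pos_of_pos hb).ne'
  rw [negPow_of_pos ha, negPow_of_pos hb, negPow_of_pos (add_pos ha hb), smul_mul_smul_comm,
    ← hconv, smul_smul]
  congr 1
  field_simp

/-- The left side is the integral of S'(t+s) over t > 0, which telescopes because S tends to 0 at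
infinity. -/
theorem IsAnalytic.negPow_one_mul_deriv (hS : S.IsAnalytic)
    (hA : ∀ z : ℂ, 0 ≤ z.re → z ∈ S.generator.resolventSet) {s : ℝ} (hs : 0 < s) :
    S.negPow 1 * deriv S.toFun s = - S.toFun s := by
  have hi := hS.integrableOn_rpow_smul hA one_pos
  obtain ⟨ω, hω, M, hM, hexp⟩ := hS.exists_norm_le_exp hA
  rw [negPow_of_pos one_pos, smul_mul_assoc, ← integral_mul_const_of_integrable hi, Real.Gamma_one,
    inv_one, one_smul]
  have hi' := hi.mul_const (deriv S.toFun s)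
  have hcongr : ∀ t ∈ Set.Ioi (0 : ℝ), t ^ ((1 : ℝ) - 1) • S.toFun t * deriv S.toFun s =
      deriv S.toFun (t + s) := by
    intro t ht
    rw [sub_self, Real.rpow_zero, one_smul, add_comm, hS.deriv_add hs (le_of_lt ht)]
  rw [setIntegral_congr_fun measurableSet_Ioi hcongr]
  have hder : ∀ t, 0 ≤ t → HasDerivAt (fun t => S.toFun (t + s)) (deriv S.toFun (t + s)) t :=
    fun t ht => (hS.differentiableAt (by positivity)).hasDerivAt.comp_add_const t s
  have hlim : Tendsto (fun t => S.toFun (t + s)) atTop (𝓝 0) := by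
    have h1 : Tendsto (fun t : ℝ => M * Real.exp (-ω * (t + s))) atTop (𝓝 0) := by
      have h2 : Tendsto (fun t : ℝ => ω * (t + s)) atTop atTop :=
        (tendsto_atTop_add_const_right _ _ tendsto_id).const_mul_atTop hω
      have h3 := (Real.tendsto_exp_neg_atTop_nhds_zero.comp h2).const_mul M
      simpa [Function.comp_def, neg_mul] using h3
    refine squeeze_zero_norm' ?_ h1
    filter_upwards [eventually_ge_atTop 0] with t ht using hexp _ (by positivity)
  rw [integral_Ioi_of_hasDerivAt_of_tendsto (hder 0 le_rfl).continuousAt.continuousWithinAt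
    (fun t ht => hder t (le_of_lt ht))
    (IntegrableOn.congr_fun hi' hcongr measurableSet_Ioi) hlim]
  simp

/-- For exponent 1, S(s) = -S'(s) (-A)^{-1} kills any kernel vector for every s > 0, and strong
continuity at 0 makes that vector zero. Integer exponents follow by iteration, and any γ ≤ n because
(-A)^{-n} factors through (-A)^{-γ}. -/
theorem IsAnalytic.negPow_injective (hS : S.IsAnalytic)
    (hA : ∀ z : ℂ, 0 ≤ z.re → z ∈ S.generator.resolventSet) {γ : ℝ} (hγ : 0 ≤ γ) :
    Function.Injective (S.negPow γ) := by
  have h1 : ∀ x, S.negPow 1 x = 0 → x = 0 := by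
    intro x hx
    have h0 : ∀ s, 0 < s → S.toFun s x = 0 := by
      intro s hs
      have hc := hS.negPow_comm hA zero_le_one (Q := deriv S.toFun s)
        fun t ht => hS.deriv_comm hs ht.le
      rw [hS.negPow_one_mul_deriv hA hs] at hc
      have := DFunLike.congr_fun hc x
      simpa [hx] using this.symm
    refine tendsto_nhds_unique (S.strongly_continuous x) ?_
    refine tendsto_const_nhds.congr' ?_
    filter_upwards [self_mem_nhdsWithin] with s hs using (h0 s hs).symm
  have hn : ∀ n : ℕ, ∀ x, S.negPow n x = 0 → x = 0 := by
    intro n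
    induction n with
    | zero => intro x hx; simpa [negPow_zero] using hx
    | succ n ih =>
      intro x hx
      rw [Nat.cast_succ, ← hS.negPow_mul hA n.cast_nonneg zero_le_one] at hx
      exact h1 x (ih _ hx)
  obtain ⟨n, hn'⟩ := exists_nat_ge γ
  refine (injective_iff_map_eq_zero _).2 fun x hx => hn n x ?_
  have := hS.negPow_mul hA (sub_nonneg.2 hn') hγ
  rw [sub_add_cancel] at this
  rw [← this, mul_apply_eq_comp, hx, map_zero]

/-! ### Smoothing estimates for (-A)^β S(s) -/

/-- The operator `(-A)^β S(s)`, for `0 < β < 1`. -/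
def fracPowMul (S : C0Semigroup H) (β s : ℝ) : H →L[ℂ] H :=
  - (S.negPow (1 - β) * deriv S.toFun s)

/-- Justifies the definition of `fracPowMul`: the exponents β and 1 - β add up to 1, and (-A)^{-1}
S'(s) = -S(s). -/
theorem IsAnalytic.negPow_mul_fracPowMul (hS : S.IsAnalytic)
    (hA : ∀ z : ℂ, 0 ≤ z.re → z ∈ S.generator.resolventSet) {β s : ℝ} (hβ : 0 ≤ β) (hβ1 : β ≤ 1)
    (hs : 0 < s) : S.negPow β * S.fracPowMul β s = S.toFun s := by
  rw [fracPowMul, mul_neg, ← mul_assoc, hS.negPow_mul hA hβ (sub_nonneg.2 hβ1), add_sub_cancel,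
    hS.negPow_one_mul_deriv hA hs, neg_neg]

omit [CompleteSpace H] in
theorem IsAnalytic.fracPowMul_add (hS : S.IsAnalytic) {β s t : ℝ} (hs : 0 < s) (ht : 0 ≤ t) :
    S.fracPowMul β (s + t) = S.fracPowMul β s * S.toFun t := by
  rw [fracPowMul, fracPowMul, neg_mul, mul_assoc, hS.deriv_add hs ht, hS.deriv_comm hs ht]

/-- The scale-free majorant for (-A)^β S(s), in the variable v = t/s: β < 1 is needed at 0 and β > 0
at infinity. -/
theorem _root_.integrableOn_rpow_neg_div {β : ℝ} (hβ : 0 < β) (hβ1 : β < 1) :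
    IntegrableOn (fun v : ℝ => v ^ (-β) / (1 + v)) (Set.Ioi 0) := by
  have hcont : ContinuousOn (fun v : ℝ => v ^ (-β) / (1 + v)) (Set.Ioi 0) := by
    intro v hv
    have hv : 0 < v := hv
    refine ContinuousAt.continuousWithinAt (ContinuousAt.div ?_ (by fun_prop) (by positivity))
    exact Real.continuousAt_rpow_const v _ (Or.inl hv.ne')
  rw [← Set.Ioc_union_Ioi_eq_Ioi zero_le_one]
  refine IntegrableOn.union ?_ ?_
  · have h1 : IntegrableOn (fun v : ℝ => v ^ (-β)) (Set.Ioc 0 1) :=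
      (intervalIntegrable_iff_integrableOn_Ioc_of_le zero_le_one).1
        (intervalIntegral.intervalIntegrable_rpow' (by linarith))
    refine h1.mono' ((hcont.mono fun v hv => hv.1).aestronglyMeasurable measurableSet_Ioc) ?_
    filter_upwards [ae_restrict_mem measurableSet_Ioc] with v hv
    have hv0 : 0 < v := hv.1
    rw [Real.norm_of_nonneg (by positivity)]
    exact div_le_self (by positivity) (by linarith)
  · have h1 : IntegrableOn (fun v : ℝ => v ^ (-β - 1)) (Set.Ioi 1) :=
      integrableOn_Ioi_rpow_of_lt (by linarith) one_pos
    refine h1.mono' ((hcont.mono (Set.Ioi_subset_Ioi zero_le_one)).aestronglyMeasurable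
      measurableSet_Ioi) ?_
    filter_upwards [ae_restrict_mem measurableSet_Ioi] with v hv
    have hv0 : 0 < v := lt_trans one_pos hv
    rw [Real.norm_of_nonneg (by positivity), Real.rpow_sub_one hv0.ne']
    gcongr
    linarith

/-- Under the integral for (-A)^{-(1-β)}, S(t) S'(s) = S'(s+t) has norm at most C/(s+t);
substituting t = s v extracts exactly s^(-β). -/
theorem IsAnalytic.exists_norm_fracPowMul_le (hS : S.IsAnalytic)
    (hA : ∀ z : ℂ, 0 ≤ z.re → z ∈ S.generator.resolventSet) {β : ℝ} (hβ : 0 < β) (hβ1 : β < 1) :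
    ∃ C > 0, ∀ s, 0 < s → ‖S.fracPowMul β s‖ ≤ C * s ^ (-β) := by
  obtain ⟨C, hC, hD⟩ := hS.exists_norm_deriv_le hA
  have hΓ : 0 < (Real.Gamma (1 - β))⁻¹ := inv_pos.2 (Real.Gamma_pos_of_pos (by linarith))
  set G : ℝ → ℝ := fun v => v ^ (-β) / (1 + v)
  have hG := integrableOn_rpow_neg_div hβ hβ1
  have hI : 0 ≤ ∫ v in Set.Ioi (0 : ℝ), G v :=
    setIntegral_nonneg measurableSet_Ioi fun v hv => by
      have : 0 < v := hv
      positivity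
  refine ⟨(Real.Gamma (1 - β))⁻¹ * (C * ∫ v in Set.Ioi (0 : ℝ), G v) + 1, by positivity,
    fun s hs => ?_⟩
  have hi := hS.integrableOn_rpow_smul hA (show 0 < 1 - β by linarith)
  have hGs : IntegrableOn (fun t => G (s⁻¹ * t)) (Set.Ioi 0) := by
    rw [integrableOn_Ioi_comp_mul_left_iff G 0 (inv_pos.2 hs), mul_zero]
    exact hG
  have hle : ‖∫ t in Set.Ioi (0 : ℝ), t ^ (1 - β - 1) • S.toFun t * deriv S.toFun s‖ ≤
      ∫ t in Set.Ioi (0 : ℝ), C * s ^ (-β - 1) * G (s⁻¹ * t) := by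
    refine norm_integral_le_of_norm_le (hGs.const_mul _) ?_
    filter_upwards [ae_restrict_mem measurableSet_Ioi] with t ht
    have ht : 0 < t := ht
    rw [smul_mul_assoc, ← hS.deriv_add hs ht.le, norm_smul, Real.norm_of_nonneg (by positivity)]
    calc _ ≤ t ^ (1 - β - 1) * (C / (s + t)) := by gcongr; exact hD _ (by positivity)
      _ = _ := by
        simp only [G]
        rw [Real.mul_rpow (by positivity) ht.le, Real.inv_rpow hs.le, ← Real.rpow_neg hs.le,
          neg_neg, Real.rpow_sub_one hs.ne', Real.rpow_neg hs.le,
          show 1 - β - 1 = -β by ring]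
        have : s ^ β ≠ 0 := by positivity
        field_simp
  rw [integral_const_mul, integral_comp_mul_left_Ioi G 0 (inv_pos.2 hs), mul_zero, inv_inv,
    smul_eq_mul] at hle
  rw [fracPowMul, norm_neg, negPow_of_pos (by linarith), smul_mul_assoc,
    ← integral_mul_const_of_integrable hi, norm_smul, Real.norm_of_nonneg hΓ.le]
  have hs' : 0 < s ^ (-β) := by positivity
  calc _ ≤ _ := mul_le_mul_of_nonneg_left hle hΓ.le
    _ = (Real.Gamma (1 - β))⁻¹ * (C * ∫ v in Set.Ioi (0 : ℝ), G v) * s ^ (-β) := by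
      rw [Real.rpow_sub_one hs.ne']
      field_simp
    _ ≤ _ := by gcongr; linarith

theorem IsAnalytic.exists_norm_sub_le (hS : S.IsAnalytic)
    (hA : ∀ z : ℂ, 0 ≤ z.re → z ∈ S.generator.resolventSet) :
    ∃ C > 0, ∀ u h, 0 < u → 0 ≤ h → ‖S.toFun (u + h) - S.toFun u‖ ≤ C * (h / u) := by
  obtain ⟨C, hC, hD⟩ := hS.exists_norm_deriv_le hA
  refine ⟨C, hC, fun u h hu hh => ?_⟩
  have := (convex_Icc u (u + h)).norm_image_sub_le_of_norm_hasDerivWithin_le (f := S.toFun)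
    (f' := deriv S.toFun) (C := C / u) (x := u) (y := u + h)
    (fun x hx => (hS.differentiableAt (hu.trans_le hx.1)).hasDerivAt.hasDerivWithinAt)
    (fun x hx => (hD x (hu.trans_le hx.1)).trans (by gcongr; exact hx.1))
    (by simpa using hh) (by simpa using hh)
  rw [add_sub_cancel_left, Real.norm_of_nonneg hh] at this
  calc _ ≤ _ := this
    _ = _ := by ring

theorem IsAnalytic.continuousOn_fracPowMul (hS : S.IsAnalytic) {β : ℝ} :
    ContinuousOn (S.fracPowMul β) (Set.Ioi 0) :=
  (continuousOn_const.mul hS.continuousOn_deriv).neg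

end C0Semigroup

/-! ### Hölder's inequality for causal kernels -/

section ConvolutionKernel

variable {E F : Type*} [NormedAddCommGroup E] [NormedSpace ℂ E] [NormedAddCommGroup F]
  [NormedSpace ℂ F]

/-- Hölder's inequality for an operator-valued kernel dominated by a scalar function. -/
theorem norm_integral_clm_apply_le {X : Type*} [MeasurableSpace X] {μ : Measure X} {p q : ℝ}
    (hpq : q.HolderConjugate p) {K : X → E →L[ℂ] F} {ψ : X → ℝ} {g : X → E}
    (hK : AEStronglyMeasurable K μ) (hψm : AEStronglyMeasurable ψ μ)
    (hψ : Integrable (fun r => ψ r ^ q) μ) (hle : ∀ᵐ r ∂μ, ‖K r‖ ≤ ψ r)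
    (hg : MemLp g (ENNReal.ofReal p) μ) :
    Integrable (fun r => K r (g r)) μ ∧
    ‖∫ r, K r (g r) ∂μ‖ ≤ (∫ r, ψ r ^ q ∂μ) ^ (1 / q) * (eLpNorm g (ENNReal.ofReal p) μ).toReal := by
  have hψ0 : 0 ≤ᵐ[μ] ψ := by
    filter_upwards [hle] with r hr using (norm_nonneg _).trans hr
  have hψL : MemLp ψ (ENNReal.ofReal q) μ := by
    rw [← integrable_norm_rpow_iff hψm (by simpa using hpq.pos) ENNReal.ofReal_ne_top,
      ENNReal.toReal_ofReal hpq.nonneg]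
    refine hψ.congr ?_
    filter_upwards [hψ0] with r hr
    rw [Real.norm_of_nonneg hr]
  have : (ENNReal.ofReal q).HolderTriple (ENNReal.ofReal p) 1 := by
    have := hpq.ennrealOfReal
    exact this
  have hprod : Integrable (fun r => ψ r * ‖g r‖) μ := hψL.integrable_mul hg.norm
  have hbound : ∀ᵐ r ∂μ, ‖K r (g r)‖ ≤ ψ r * ‖g r‖ := by
    filter_upwards [hle] with r hr
    exact (K r).le_of_opNorm_le hr _
  refine ⟨hprod.mono' ?_ hbound, ?_⟩
  · exact (ContinuousLinearMap.id ℂ (E →L[ℂ] F)).aestronglyMeasurable_comp₂ hK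
      hg.aestronglyMeasurable
  refine (norm_integral_le_of_norm_le hprod hbound).trans ?_
  refine (integral_mul_le_Lp_mul_Lq_of_nonneg hpq hψ0 (ae_of_all _ fun r => norm_nonneg _) hψL
    hg.norm).trans (le_of_eq ?_)
  rw [hg.eLpNorm_eq_integral_rpow_norm (by simpa using hpq.symm.pos) ENNReal.ofReal_ne_top,
    ENNReal.toReal_ofReal hpq.symm.nonneg, ENNReal.toReal_ofReal (by positivity), one_div p]

/-- The profile that dominates the differences of a kernel of order `a - 1`. -/
def kernelProfile (a v : ℝ) : ℝ :=
  if v ≤ -1 then 0 else if v ≤ 0 then (v + 1) ^ (a - 1) else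
    if v ≤ 1 then 2 * v ^ (a - 1) else v ^ (a - 2)

theorem measurable_kernelProfile (a : ℝ) : Measurable (kernelProfile a) := by
  unfold kernelProfile
  refine Measurable.ite measurableSet_Iic measurable_const ?_
  refine Measurable.ite measurableSet_Iic (by fun_prop) ?_
  exact Measurable.ite measurableSet_Iic (by fun_prop) (by fun_prop)

theorem kernelProfile_nonneg (a v : ℝ) : 0 ≤ kernelProfile a v := by
  unfold kernelProfile
  split_ifs with h1 h2 h3
  · exact le_rfl
  · exact Real.rpow_nonneg (by linarith) _
  · exact mul_nonneg zero_le_two (Real.rpow_nonneg (by linarith) _)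
  · exact Real.rpow_nonneg (by linarith) _

/-- The first condition on the exponents handles the singularities at -1 and 0, the second the tail
at infinity. -/
theorem integrable_kernelProfile_rpow {a q : ℝ} (hq : 0 < q) (h1 : -1 < (a - 1) * q)
    (h2 : (a - 2) * q < -1) : Integrable (fun v => kernelProfile a v ^ q) := by
  have e1 : IntegrableOn (fun v : ℝ => v ^ ((a - 1) * q)) (Set.Ioc 0 1) :=
    (intervalIntegrable_iff_integrableOn_Ioc_of_le zero_le_one).1
      (intervalIntegral.intervalIntegrable_rpow' h1)
  have e2 : IntegrableOn (fun v : ℝ => (v + 1) ^ ((a - 1) * q)) (Set.Ioc (-1) 0) := by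
    have h3 : IntervalIntegrable (fun v : ℝ => v ^ ((a - 1) * q)) volume 0 1 :=
      intervalIntegral.intervalIntegrable_rpow' h1
    have h4 := h3.comp_add_right 1
    rw [zero_sub, sub_self] at h4
    exact (intervalIntegrable_iff_integrableOn_Ioc_of_le (by norm_num)).1 h4
  have e3 : IntegrableOn (fun v : ℝ => v ^ ((a - 2) * q)) (Set.Ioi 1) :=
    integrableOn_Ioi_rpow_of_lt h2 one_pos
  rw [← integrableOn_univ, ← Set.Iic_union_Ioi (a := (-1 : ℝ)),
    ← Set.Ioc_union_Ioi_eq_Ioi (show (-1 : ℝ) ≤ 0 by norm_num),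
    ← Set.Ioc_union_Ioi_eq_Ioi zero_le_one]
  refine IntegrableOn.union ?_ (IntegrableOn.union ?_ (IntegrableOn.union ?_ ?_))
  · refine (integrableOn_zero (ε' := ℝ)).congr_fun (fun v hv => ?_) measurableSet_Iic
    have hv : v ≤ -1 := hv
    simp [kernelProfile, hv, hq.ne']
  · refine e2.congr_fun (fun v hv => ?_) measurableSet_Ioc
    simp only [kernelProfile]
    rw [if_neg (not_le.2 hv.1), if_pos hv.2, ← Real.rpow_mul (by linarith [hv.1])]
  · refine IntegrableOn.congr_fun (e1.const_mul (2 ^ q)) (fun v hv => ?_) measurableSet_Ioc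
    simp only [kernelProfile]
    rw [if_neg (by linarith [hv.1]), if_neg (not_le.2 hv.1), if_pos hv.2,
      Real.mul_rpow zero_le_two (Real.rpow_nonneg hv.1.le _), ← Real.rpow_mul hv.1.le]
  · refine e3.congr_fun (fun v hv => ?_) measurableSet_Ioi
    have hv : 1 < v := hv
    simp only [kernelProfile]
    rw [if_neg (by linarith), if_neg (by linarith), if_neg (not_le.2 hv),
      ← Real.rpow_mul (by linarith)]

/-- A causal kernel on the line of order `a - 1`: it vanishes on `(-∞, 0]`, is continuous on
`(0, ∞)`, and there `‖K u‖ ≤ C u ^ (a - 1)` and `‖K (u + h) - K u‖ ≤ C h u ^ (a - 2)`. -/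
structure IsCausalKernel (K : ℝ → F) (a C : ℝ) : Prop where
  zero : ∀ u, u ≤ 0 → K u = 0
  cont : ContinuousOn K (Set.Ioi 0)
  bound : ∀ u, 0 < u → ‖K u‖ ≤ C * u ^ (a - 1)
  bound_sub : ∀ u h, 0 < u → 0 < h → ‖K (u + h) - K u‖ ≤ C * (h * u ^ (a - 2))

namespace IsCausalKernel

variable {a C : ℝ}

omit [NormedSpace ℂ F] in
theorem nonneg {K : ℝ → F} (hK : IsCausalKernel K a C) : 0 ≤ C := by
  simpa using (norm_nonneg _).trans (hK.bound 1 one_pos)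

omit [NormedSpace ℂ F] in
-- The cuts are at u = -h, 0 and h: both values vanish, then only the shifted one survives, then the
-- two are bounded separately, since u^(a-1) is nonincreasing. Past u = h the difference bound
-- supplies the extra decay.
theorem norm_sub_le {K : ℝ → F} (hK : IsCausalKernel K a C) (ha : a ≤ 1) {h : ℝ} (hh : 0 < h)
    (u : ℝ) : ‖K (u + h) - K u‖ ≤ C * h ^ (a - 1) * kernelProfile a (u / h) := by
  have hC := hK.nonneg
  unfold kernelProfile
  split_ifs with h1 h2 h3
  · rw [div_le_iff₀ hh] at h1
    rw [hK.zero _ (by linarith), hK.zero _ (by linarith)]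
    simp
  · rw [not_le, lt_div_iff₀ hh] at h1
    rw [div_le_iff₀ hh] at h2
    rw [hK.zero u (by linarith), sub_zero, mul_assoc,
      ← Real.mul_rpow hh.le (by rw [div_add_one hh.ne']; exact div_nonneg (by linarith) hh.le)]
    have : h * (u / h + 1) = u + h := by field_simp
    rw [this]
    exact hK.bound _ (by linarith)
  · rw [not_le, lt_div_iff₀ hh, zero_mul] at h2
    have h5 : C * h ^ (a - 1) * (2 * (u / h) ^ (a - 1)) = 2 * (C * u ^ (a - 1)) := by
      rw [Real.div_rpow h2.le hh.le]
      field_simp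
    rw [h5, two_mul]
    refine (_root_.norm_sub_le _ _).trans (add_le_add ((hK.bound _ (by linarith)).trans ?_)
      (hK.bound u h2))
    gcongr 1
    exact Real.rpow_le_rpow_of_nonpos h2 (by linarith) (by linarith)
  · rw [not_le, lt_div_iff₀ hh, one_mul] at h3
    have hu : 0 < u := hh.trans h3
    refine (hK.bound_sub u h hu hh).trans (le_of_eq ?_)
    rw [Real.div_rpow hu.le hh.le, show a - 1 = a - 2 + 1 by ring, Real.rpow_add_one hh.ne']
    field_simp

omit [NormedSpace ℂ F] in
theorem aestronglyMeasurable {K : ℝ → F} (hK : IsCausalKernel K a C) :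
    AEStronglyMeasurable K := by
  have h1 : AEStronglyMeasurable ((Set.Ioi (0 : ℝ)).indicator K) :=
    (aestronglyMeasurable_indicator_iff measurableSet_Ioi).2
      (hK.cont.aestronglyMeasurable measurableSet_Ioi)
  convert h1 using 1
  funext u
  by_cases hu : u ∈ Set.Ioi (0 : ℝ)
  · rw [Set.indicator_of_mem hu]
  · rw [Set.indicator_of_notMem hu, hK.zero u (not_lt.1 hu)]

/-- The Hölder exponent comes from scaling: h^(a-1) from the amplitude of the profile and h^(1/q)
from its width multiply to h^(a-1/p). -/
theorem sub_estimate {K : ℝ → E →L[ℂ] F} (hK : IsCausalKernel K a C) {p q : ℝ}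
    (hpq : q.HolderConjugate p) (ha : 1 / p < a) (ha1 : a ≤ 1) {s : Set ℝ} {g : ℝ → E}
    (hg : MemLp g (ENNReal.ofReal p) (volume.restrict s)) {t₁ t₂ : ℝ} (ht : t₁ < t₂) :
    Integrable (fun r => (K (t₂ - r) - K (t₁ - r)) (g r)) (volume.restrict s) ∧
    ‖∫ r in s, (K (t₂ - r) - K (t₁ - r)) (g r)‖ ≤
      C * (∫ v, kernelProfile a v ^ q) ^ (1 / q) * (t₂ - t₁) ^ (a - 1 / p) *
        (eLpNorm g (ENNReal.ofReal p) (volume.restrict s)).toReal := by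
  set h := t₂ - t₁ with hh'
  have hh : 0 < h := sub_pos.2 ht
  have hq := hpq.pos
  have hp := hpq.symm.pos
  have hqp : 1 / q + 1 / p = 1 := by
    simpa using hpq.inv_add_inv_eq_one
  have hqq : 1 / q * q = 1 := by field_simp
  have hC := hK.nonneg
  -- Since 1/q = 1 - 1/p, this is a > 1/p; the next bound follows from a ≤ 1 and q > 1.
  have hi1 : -1 < (a - 1) * q := by nlinarith
  have hi2 : (a - 2) * q < -1 := by nlinarith [hpq.lt]
  have hint := integrable_kernelProfile_rpow hq hi1 hi2
  set ψ : ℝ → ℝ := fun r => C * h ^ (a - 1) * kernelProfile a ((t₁ - r) / h) with hψdef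
  have hψq : ∀ r, ψ r ^ q = (C * h ^ (a - 1)) ^ q * kernelProfile a ((t₁ - r) / h) ^ q := fun r => by
    rw [hψdef, Real.mul_rpow (by positivity) (kernelProfile_nonneg _ _)]
  have hψi : Integrable (fun r => ψ r ^ q) := by
    simp only [hψq]
    exact ((hint.comp_div hh.ne').comp_sub_left t₁).const_mul _
  have hψm : Measurable ψ :=
    ((measurable_kernelProfile a).comp (by fun_prop)).const_mul _
  have hKm : AEStronglyMeasurable (fun r => K (t₂ - r) - K (t₁ - r)) := by
    have hm := hK.aestronglyMeasurable
    exact (hm.comp_measurePreserving (Measure.measurePreserving_sub_left volume t₂)).sub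
      (hm.comp_measurePreserving (Measure.measurePreserving_sub_left volume t₁))
  have hle : ∀ r, ‖K (t₂ - r) - K (t₁ - r)‖ ≤ ψ r := fun r => by
    have := hK.norm_sub_le ha1 hh (t₁ - r)
    rwa [show t₁ - r + h = t₂ - r by rw [hh']; ring] at this
  obtain ⟨h1, h2⟩ := norm_integral_clm_apply_le hpq hKm.restrict hψm.aestronglyMeasurable
    hψi.restrict (ae_of_all _ hle) hg
  refine ⟨h1, h2.trans ?_⟩
  gcongr
  have hP : 0 ≤ ∫ v, kernelProfile a v ^ q :=
    integral_nonneg fun v => Real.rpow_nonneg (kernelProfile_nonneg _ _) _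
  calc (∫ r in s, ψ r ^ q) ^ (1 / q) ≤ (∫ r, ψ r ^ q) ^ (1 / q) := by
        have h0 : ∀ r, 0 ≤ ψ r ^ q := fun r =>
          Real.rpow_nonneg ((norm_nonneg _).trans (hle r)) _
        refine Real.rpow_le_rpow (integral_nonneg h0) ?_ (by positivity)
        exact setIntegral_le_integral hψi (ae_of_all _ h0)
    _ = ((C * h ^ (a - 1)) ^ q * (h * ∫ v, kernelProfile a v ^ q)) ^ (1 / q) := by
        congr 1
        simp only [hψq]
        rw [integral_const_mul,
          integral_sub_left_eq_self (fun u => kernelProfile a (u / h) ^ q) volume t₁,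
          Measure.integral_comp_div (fun v => kernelProfile a v ^ q), abs_of_pos hh, smul_eq_mul]
    _ = _ := by
        rw [Real.mul_rpow (by positivity) (by positivity), Real.mul_rpow hh.le hP,
          ← Real.rpow_mul (by positivity), mul_one_div_cancel hq.ne', Real.rpow_one,
          show a - 1 / p = (a - 1) + 1 / q by linarith, Real.rpow_add hh]
        ring

/-- The convolution of a causal kernel with an `L^p` function is integrable. -/
theorem integrable {K : ℝ → E →L[ℂ] F} (hK : IsCausalKernel K a C) {p q : ℝ}
    (hpq : q.HolderConjugate p) (ha : 1 / p < a) (ha1 : a ≤ 1) {T : ℝ} {g : ℝ → E}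
    (hg : MemLp g (ENNReal.ofReal p) (volume.restrict (Set.Ioo 0 T))) {t : ℝ} (ht : 0 ≤ t) :
    Integrable (fun r => K (t - r) (g r)) (volume.restrict (Set.Ioo 0 T)) := by
  rcases ht.eq_or_lt with rfl | ht
  · refine (integrable_zero ℝ F _).congr ?_
    filter_upwards [ae_restrict_mem measurableSet_Ioo] with r hr
    rw [hK.zero _ (by linarith [hr.1])]
    simp
  -- Compare with time 0, where the causal kernel vanishes on (0, T).
  · refine (hK.sub_estimate hpq ha ha1 hg ht).1.congr ?_
    filter_upwards [ae_restrict_mem measurableSet_Ioo] with r hr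
    rw [hK.zero (0 - r) (by linarith [hr.1]), sub_zero]

/-- Hölder continuity in time of the convolution of a causal kernel with an `L^p` function. -/
theorem exists_norm_convolution_sub_le {K : ℝ → E →L[ℂ] F} (hK : IsCausalKernel K a C) {p : ℝ}
    (hp : 1 < p) (ha : 1 / p < a) (ha1 : a ≤ 1) (T : ℝ) :
    ∃ C' : ℝ≥0, ∀ g : ℝ → E, MemLp g (ENNReal.ofReal p) (volume.restrict (Set.Ioo 0 T)) →
      ∀ t₁ t₂ : ℝ, 0 ≤ t₁ → 0 ≤ t₂ →
      ‖(∫ r in Set.Ioo 0 T, K (t₂ - r) (g r)) - ∫ r in Set.Ioo 0 T, K (t₁ - r) (g r)‖ ≤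
        C' * |t₂ - t₁| ^ (a - 1 / p) *
          (eLpNorm g (ENNReal.ofReal p) (volume.restrict (Set.Ioo 0 T))).toReal := by
  have hpq := (Real.HolderConjugate.conjExponent hp).symm
  set q := p.conjExponent
  have hP : 0 ≤ ∫ v, kernelProfile a v ^ q :=
    integral_nonneg fun v => Real.rpow_nonneg (kernelProfile_nonneg _ _) _
  have hC := hK.nonneg
  refine ⟨NNReal.mk (C * (∫ v, kernelProfile a v ^ q) ^ (1 / q)) (by positivity), fun g hg => ?_⟩
  have key : ∀ t₁ t₂ : ℝ, 0 ≤ t₁ → t₁ < t₂ →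
      ‖(∫ r in Set.Ioo 0 T, K (t₂ - r) (g r)) - ∫ r in Set.Ioo 0 T, K (t₁ - r) (g r)‖ ≤
      C * (∫ v, kernelProfile a v ^ q) ^ (1 / q) * |t₂ - t₁| ^ (a - 1 / p) *
          (eLpNorm g (ENNReal.ofReal p) (volume.restrict (Set.Ioo 0 T))).toReal := by
    intro t₁ t₂ ht₁ ht
    rw [← integral_sub (hK.integrable hpq ha ha1 hg (ht₁.trans ht.le))
      (hK.integrable hpq ha ha1 hg ht₁), abs_of_pos (sub_pos.2 ht)]
    exact (hK.sub_estimate hpq ha ha1 hg ht).2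
  intro t₁ t₂ ht₁ ht₂
  rcases lt_trichotomy t₁ t₂ with h | rfl | h
  · exact key t₁ t₂ ht₁ h
  · rw [sub_self, norm_zero, NNReal.coe_mk]; positivity
  · rw [norm_sub_rev, abs_sub_comm]; exact key t₂ t₁ ht₂ h

end IsCausalKernel

end ConvolutionKernel

/-! ### The singular kernel built from S and the spaces Ḣ^γ -/

theorem rpow_sub_rpow_add_le {α u h : ℝ} (hα : 0 ≤ α) (hu : 0 < u) (hh : 0 ≤ h) :
    u ^ (α - 1) - (u + h) ^ (α - 1) ≤ h * u ^ (α - 2) := by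
  have huh : 0 < u + h := by positivity
  -- Replacing (u+h)^α by the smaller u^α reduces the difference of powers to u^(α-1) h / (u+h).
  have h1 : u ^ α / (u + h) ≤ (u + h) ^ (α - 1) := by
    rw [Real.rpow_sub_one huh.ne']
    gcongr
    linarith
  have h2 : u ^ (α - 1) - u ^ α / (u + h) ≤ h * u ^ (α - 2) := by
    rw [Real.rpow_sub_one hu.ne', show α - 2 = α - 1 - 1 by ring, Real.rpow_sub_one hu.ne',
      Real.rpow_sub_one hu.ne']
    have h3 : u ^ α / u - u ^ α / (u + h) = h * (u ^ α / u / (u + h)) := by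
      field_simp
      ring
    rw [h3]
    gcongr
    linarith
  linarith

/-- Multiplication by `u ^ (α - 1)` turns a family of operators of order `-β` into a causal
kernel. -/
theorem isCausalKernel_rpow_smul {F : Type*} [NormedAddCommGroup F] [NormedSpace ℝ F] {B : ℝ → F}
    {α β C : ℝ} (hα : 0 ≤ α) (hα1 : α ≤ 1) (hC : 0 ≤ C) (hc : ContinuousOn B (Set.Ioi 0))
    (hB : ∀ u, 0 < u → ‖B u‖ ≤ C * u ^ (-β))
    (hB' : ∀ u h, 0 < u → 0 < h → ‖B (u + h) - B u‖ ≤ C * (h * u ^ (-β - 1))) :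
    IsCausalKernel (fun u => if u ≤ 0 then 0 else u ^ (α - 1) • B u) (α - β) (2 * C) where
  zero u hu := if_pos hu
  cont := by
    have h1 : ContinuousOn (fun u : ℝ => u ^ (α - 1) • B u) (Set.Ioi 0) :=
      ContinuousOn.smul (f := fun u : ℝ => u ^ (α - 1)) (g := B)
        (fun t ht => (Real.continuousAt_rpow_const t _ (Or.inl (ne_of_gt ht))).continuousWithinAt) hc
    exact h1.congr fun u hu => if_neg (not_le.2 hu)
  bound u hu := by
    rw [if_neg (not_le.2 hu), norm_smul, Real.norm_of_nonneg (by positivity)]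
    calc _ ≤ u ^ (α - 1) * (C * u ^ (-β)) := by gcongr; exact hB u hu
      _ = C * u ^ (α - β - 1) := by
        rw [show α - β - 1 = (α - 1) + -β by ring, Real.rpow_add hu]; ring
      _ ≤ _ := by gcongr; linarith
  bound_sub u h hu hh := by
    rw [if_neg (by linarith), if_neg (not_le.2 hu)]
    have h1 : (u + h) ^ (α - 1) • B (u + h) - u ^ (α - 1) • B u =
        (u + h) ^ (α - 1) • (B (u + h) - B u) - (u ^ (α - 1) - (u + h) ^ (α - 1)) • B u := by
      module
    have h2 : (u + h) ^ (α - 1) ≤ u ^ (α - 1) :=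
      Real.rpow_le_rpow_of_nonpos hu (by linarith) (by linarith)
    rw [h1]
    refine (norm_sub_le _ _).trans ?_
    rw [norm_smul, norm_smul, Real.norm_of_nonneg (by positivity),
      Real.norm_of_nonneg (sub_nonneg.2 h2)]
    calc _ ≤ u ^ (α - 1) * (C * (h * u ^ (-β - 1))) + h * u ^ (α - 2) * (C * u ^ (-β)) := by
          gcongr
          · exact hB' u h hu hh
          · exact rpow_sub_rpow_add_le hα hu hh.le
          · exact hB u hu
      _ = _ := by
        rw [show α - β - 2 = (α - 2) + -β by ring, Real.rpow_add hu,
          show α - 1 = α - 2 + 1 by ring, Real.rpow_add_one hu.ne', Real.rpow_sub_one hu.ne']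
        field_simp
        ring

namespace C0Semigroup

variable {H : Type*} [NormedAddCommGroup H] [InnerProductSpace ℂ H] [CompleteSpace H]
  {S : C0Semigroup H}

/-- The operators `(-A)^{θ/2} S(u) (-A)^{-ρ/2}` and their size as `u ↓ 0`. -/
theorem IsAnalytic.exists_factor (hS : S.IsAnalytic)
    (hA : ∀ z : ℂ, 0 ≤ z.re → z ∈ S.generator.resolventSet) {ρ θ : ℝ} (hρ : 0 ≤ ρ) (hθ : 0 ≤ θ)
    (hβ1 : max ((θ - ρ) / 2) 0 < 1) :
    ∃ (B : ℝ → H →L[ℂ] H) (C : ℝ), 0 ≤ C ∧ ContinuousOn B (Set.Ioi 0) ∧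
      (∀ u, 0 < u → ‖B u‖ ≤ C * u ^ (-max ((θ - ρ) / 2) 0)) ∧
      (∀ u h, 0 < u → 0 < h → ‖B (u + h) - B u‖ ≤ C * (h * u ^ (-max ((θ - ρ) / 2) 0 - 1))) ∧
      ∀ u, 0 < u → S.negPow (θ / 2) * B u = S.toFun u * S.negPow (ρ / 2) := by
  obtain ⟨C₁, hC₁, hsub⟩ := hS.exists_norm_sub_le hA
  have hcomm : ∀ u γ, 0 < u → 0 ≤ γ → S.toFun u * S.negPow γ = S.negPow γ * S.toFun u :=
    fun u γ hu hγ => hS.negPow_comm hA hγ fun t ht => toFun_comm hu.le ht.le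
  rcases le_or_gt θ ρ with h | h
  · rw [max_eq_right (by linarith), neg_zero]
    obtain ⟨ω, hω, M, hM, hexp⟩ := hS.exists_norm_le_exp hA
    -- The surplus regularity of the data is a bounded operator, so only S(u) has to be estimated.
    set P := S.negPow ((ρ - θ) / 2)
    refine ⟨fun u => S.toFun u * P, (M + C₁) * ‖P‖, by positivity,
      hS.continuousOn.mul continuousOn_const, fun u hu => ?_, fun u h hu hh => ?_, fun u hu => ?_⟩
    · rw [Real.rpow_zero, mul_one]
      refine (norm_mul_le _ _).trans ?_
      gcongr
      refine (hexp u hu.le).trans ?_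
      have : Real.exp (-ω * u) ≤ 1 := Real.exp_le_one_iff.2 (by nlinarith)
      nlinarith
    · rw [← sub_mul, zero_sub, Real.rpow_neg_one, ← div_eq_mul_inv]
      refine (norm_mul_le _ _).trans ?_
      calc _ ≤ C₁ * (h / u) * ‖P‖ := by gcongr; exact hsub u h hu hh.le
        _ ≤ (M + C₁) * (h / u) * ‖P‖ := by gcongr; linarith
        _ = _ := by ring
    · rw [show ρ / 2 = θ / 2 + (ρ - θ) / 2 by ring, ← hS.negPow_mul hA (by linarith) (by linarith),
        ← mul_assoc, ← mul_assoc, hcomm u _ hu (by linarith)]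
  · have hβ0 : 0 < (θ - ρ) / 2 := by linarith
    rw [max_eq_left hβ0.le] at hβ1 ⊢
    set β := (θ - ρ) / 2 with hβ
    obtain ⟨C, hC, hb⟩ := hS.exists_norm_fracPowMul_le hA hβ0 hβ1
    refine ⟨S.fracPowMul β, C + C * 2 ^ β * (C₁ * 2), by positivity, hS.continuousOn_fracPowMul,
      fun u hu => ?_, fun u h hu hh => ?_, fun u hu => ?_⟩
    · refine (hb u hu).trans ?_
      gcongr
      have : 0 ≤ C * 2 ^ β * (C₁ * 2) := by positivity
      linarith
    · have hu2 : 0 < u / 2 := by positivity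
      -- Share the time u equally: one half carries (-A)^β and costs u^(-β), the other carries the
      -- increment and costs h/u.
      have h1 : S.fracPowMul β (u + h) - S.fracPowMul β u =
          S.fracPowMul β (u / 2) * (S.toFun (u / 2 + h) - S.toFun (u / 2)) := by
        rw [mul_sub, ← hS.fracPowMul_add hu2 (by positivity), ← hS.fracPowMul_add hu2 hu2.le]
        congr 2 <;> ring
      rw [h1]
      refine (norm_mul_le _ _).trans ?_
      calc _ ≤ (C * (u / 2) ^ (-β)) * (C₁ * (h / (u / 2))) := by
            gcongr
            · exact hb _ hu2
            · exact hsub _ h hu2 hh.le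
        _ = C * 2 ^ β * (C₁ * 2) * (h * u ^ (-β - 1)) := by
            rw [Real.rpow_sub_one hu.ne', Real.div_rpow hu.le zero_le_two,
              Real.rpow_neg zero_le_two]
            field_simp
        _ ≤ _ := by gcongr; linarith
    · rw [show θ / 2 = ρ / 2 + β by rw [hβ]; ring, ← hS.negPow_mul hA (by linarith) hβ0.le,
        mul_assoc, hS.negPow_mul_fracPowMul hA hβ0.le hβ1.le hu, hcomm u _ hu (by linarith)]

/-- The norm of `Ḣ^γ` makes `(-A)^{γ/2}` an isometry. -/
def DotH.powIsometry (S : C0Semigroup H) (γ : ℝ) : DotH S γ →ₗᵢ[ℂ] H where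
  toLinearMap := DotH.pow S γ
  norm_map' _ := rfl

theorem DotH.negPow_pow (γ : ℝ) (x : DotH S γ) : S.negPow (γ / 2) (DotH.pow S γ x) = DotH.incl S γ x :=
  S.negPow_fracPow (γ / 2) x

/-- The operator `(-A)^{-γ/2}` as an isometry from `H` to `Ḣ^γ`. -/
def DotH.ofPow (S : C0Semigroup H) (γ : ℝ) (hinj : Function.Injective (S.negPow (γ / 2))) :
    H →ₗᵢ[ℂ] DotH S γ where
  toLinearMap := (S.negPow (γ / 2) : H →ₗ[ℂ] H).rangeRestrict
  norm_map' x := congrArg norm (S.fracPow_negPow (γ / 2) hinj x ⟨x, rfl⟩)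

theorem DotH.ofPow_surjective {γ : ℝ} (hinj : Function.Injective (S.negPow (γ / 2))) :
    Function.Surjective (DotH.ofPow S γ hinj) := by
  rintro ⟨_, x, rfl⟩
  exact ⟨x, rfl⟩

/-- Needed to move the inclusion into H through Bochner integrals in Ḣ^γ, which are zero by
convention in an incomplete space. -/
theorem DotH.completeSpace {γ : ℝ} (hinj : Function.Injective (S.negPow (γ / 2))) :
    CompleteSpace (DotH S γ) :=
  (LinearIsometryEquiv.ofSurjective _ (DotH.ofPow_surjective hinj)).symm.toIsometryEquiv.completeSpace

end C0Semigroup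

/-! ### Convolution operators from L^p to Hölder spaces -/

section HolderConvolution

variable {E F : Type*} [NormedAddCommGroup E] [NormedSpace ℂ E] [NormedAddCommGroup F]
  [NormedSpace ℂ F]

omit [NormedSpace ℂ F] in
-- On an interval of length T, lowering the exponent from e to η costs a factor T^(e-η).
theorem holderWith_of_norm_sub_le {T : ℝ} {u : Set.Icc (0 : ℝ) T → F} {C e : ℝ} {η : ℝ≥0}
    (hC : 0 ≤ C) (hη : (η : ℝ) ≤ e)
    (hu : ∀ t₁ t₂ : Set.Icc (0 : ℝ) T, ‖u t₂ - u t₁‖ ≤ C * |(t₂ : ℝ) - t₁| ^ e) :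
    HolderWith (Real.toNNReal (T ^ (e - η) * C)) η u := by
  intro t₂ t₁
  have h0 : (0 : ℝ) ≤ T := t₁.2.1.trans t₁.2.2
  rw [edist_dist, edist_dist, ENNReal.ofReal_rpow_of_nonneg dist_nonneg η.coe_nonneg]
  change _ ≤ ENNReal.ofReal _ * _
  rw [← ENNReal.ofReal_mul (by positivity)]
  refine ENNReal.ofReal_le_ofReal ?_
  rcases eq_or_ne t₂ t₁ with rfl | hne
  · rw [dist_self]; positivity
  have hd : 0 < |(t₂ : ℝ) - t₁| := abs_pos.2 (sub_ne_zero.2 fun h => hne (Subtype.ext h))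
  have hdT : |(t₂ : ℝ) - t₁| ≤ T := by
    rw [abs_le]; constructor <;> linarith [t₁.2.1, t₁.2.2, t₂.2.1, t₂.2.2]
  rw [dist_eq_norm, Subtype.dist_eq, Real.dist_eq]
  calc _ ≤ _ := hu t₁ t₂
    _ = |(t₂ : ℝ) - t₁| ^ (e - η) * C * |(t₂ : ℝ) - t₁| ^ (η : ℝ) := by
      conv_lhs => rw [show e = (e - η) + η by ring, Real.rpow_add hd]
      ring
    _ ≤ _ := by
      gcongr

/-- Convolution with a causal kernel of order `a - 1` is bounded from `L^p(0, T; E)` to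
`C^δ([0, T]; F)` for `δ ≤ a - 1/p`. -/
theorem IsCausalKernel.exists_convolution {K : ℝ → E →L[ℂ] F} {a C : ℝ}
    (hK : IsCausalKernel K a C) {T : ℝ} (hT : 0 < T) {p : ℝ≥0∞} [Fact (1 ≤ p)] (hp : 1 < p)
    (hp_top : p ≠ ∞) (ha : 1 / p.toReal < a) (ha1 : a ≤ 1) {δ : ℝ≥0}
    (hδ : (δ : ℝ) ≤ a - 1 / p.toReal) :
    ∃ R : Lp E p (volume.restrict (Set.Ioo 0 T)) →L[ℂ] HolderSpace δ T F,
      ∀ (f : Lp E p (volume.restrict (Set.Ioo 0 T))) (t : Set.Icc (0 : ℝ) T),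
        Integrable (fun r => K (t - r) (f r)) (volume.restrict (Set.Ioo 0 T)) ∧
        HolderSpace.toCont (R f) t = ∫ r in Set.Ioo 0 T, K (t - r) (f r) := by
  have hp1 : 1 < p.toReal := by
    rw [← ENNReal.toReal_one]
    exact (ENNReal.toReal_lt_toReal ENNReal.one_ne_top hp_top).2 hp
  obtain ⟨C', hC'⟩ := hK.exists_norm_convolution_sub_le hp1 ha ha1 T
  rw [ENNReal.ofReal_toReal hp_top] at hC'
  set e := a - 1 / p.toReal with he
  have he0 : 0 < e := sub_pos.2 ha
  let μ := volume.restrict (Set.Ioo 0 T)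
  let y : Lp E p μ → Set.Icc (0 : ℝ) T → F := fun f t => ∫ r in Set.Ioo 0 T, K (t - r) (f r)
  have hint : ∀ (f : Lp E p μ) (t : Set.Icc (0 : ℝ) T), Integrable (fun r => K (t - r) (f r)) μ :=
    fun f t => hK.integrable (Real.HolderConjugate.conjExponent hp1).symm ha ha1
      (by rw [ENNReal.ofReal_toReal hp_top]; exact Lp.memLp f) t.2.1
  have hy : ∀ (f : Lp E p μ) (t₁ t₂ : Set.Icc (0 : ℝ) T),
      ‖y f t₂ - y f t₁‖ ≤ C' * ‖f‖ * |(t₂ : ℝ) - t₁| ^ e := fun f t₁ t₂ => by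
    refine (hC' f (Lp.memLp f) t₁ t₂ t₁.2.1 t₂.2.1).trans (le_of_eq ?_)
    rw [Lp.norm_def]
    ring
  have hhold : ∀ (f : Lp E p μ) (η : ℝ≥0), (η : ℝ) ≤ e →
      HolderWith (Real.toNNReal (T ^ (e - η) * (C' * ‖f‖))) η (y f) := fun f η hη =>
    holderWith_of_norm_sub_le (by positivity) hη (hy f)
  -- Continuity is taken from the exponent e > 0, because δ may be 0.
  have hcont : ∀ f, Continuous (y f) := fun f =>
    (hhold f ⟨e, he0.le⟩ le_rfl).continuous he0
  have hbound : ∀ f t, ‖y f t‖ ≤ T ^ e * (C' * ‖f‖) := by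
    intro f t
    -- As the convolution starts at 0, its Hölder bound also controls its supremum.
    have h0 : y f ⟨0, le_rfl, hT.le⟩ = 0 := by
      refine (setIntegral_congr_fun measurableSet_Ioo fun r hr => ?_).trans (integral_zero _ _)
      simp only
      rw [hK.zero _ (by linarith [hr.1])]
      simp
    have h1 := hy f ⟨0, le_rfl, hT.le⟩ t
    rw [h0, sub_zero, sub_zero, abs_of_nonneg t.2.1] at h1
    refine h1.trans ?_
    rw [mul_comm]
    gcongr
    · exact t.2.1
    · exact t.2.2
  let R₀ : Lp E p μ →ₗ[ℂ] HolderSpace δ T F :=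
    { toFun := fun f => (⟨⟨y f, hcont f⟩, ⟨_, hhold f δ hδ⟩⟩ : holderSubmodule δ T F)
      map_add' := by
        intro f g
        refine Subtype.ext (ContinuousMap.ext fun t => ?_)
        refine Eq.trans ?_ (integral_add (hint f t) (hint g t))
        refine integral_congr_ae ?_
        filter_upwards [Lp.coeFn_add f g] with r hr
        rw [hr, Pi.add_apply, map_add]
      map_smul' := by
        intro c f
        refine Subtype.ext (ContinuousMap.ext fun t => ?_)
        refine Eq.trans ?_ (integral_smul c _)
        refine integral_congr_ae ?_
        filter_upwards [Lp.coeFn_smul c f] with r hr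
        rw [hr, Pi.smul_apply, map_smul] }
  refine ⟨R₀.mkContinuous (T ^ e * C' + T ^ (e - δ) * C') fun f => ?_, fun f t => ⟨hint f t, rfl⟩⟩
  rw [HolderSpace.norm_eq, add_mul]
  refine add_le_add ?_ ?_
  · refine (ContinuousMap.norm_le _ (by positivity)).2 fun t => (hbound f t).trans (le_of_eq ?_)
    ring
  · have h1 := NNReal.coe_le_coe.2 (hhold f δ hδ).nnholderNorm_le
    rw [Real.coe_toNNReal _ (by positivity), ← mul_assoc] at h1
    exact h1

end HolderConvolution

/-! ### The kernel between the spaces Ḣ and the conclusion -/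

theorem IsCausalKernel.map {F G : Type*} [NormedAddCommGroup F] [NormedSpace ℂ F]
    [NormedAddCommGroup G] [NormedSpace ℂ G] {K : ℝ → F} {a C : ℝ} (hK : IsCausalKernel K a C)
    (Φ : F →L[ℂ] G) (hΦ : ∀ x, ‖Φ x‖ ≤ ‖x‖) : IsCausalKernel (fun u => Φ (K u)) a C where
  zero u hu := by rw [hK.zero u hu, map_zero]
  cont := Φ.continuous.comp_continuousOn hK.cont
  bound u hu := (hΦ _).trans (hK.bound u hu)
  bound_sub u h hu hh := by
    rw [← map_sub]
    exact (hΦ _).trans (hK.bound_sub u h hu hh)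

open C0Semigroup in
/-- The operators `u ^ (α - 1) (-A)^{θ/2} S(u) (-A)^{-ρ/2}` as a causal kernel with values in the
operators from `Ḣ^ρ` to `Ḣ^θ`. -/
theorem C0Semigroup.IsAnalytic.exists_kernel {H : Type*} [NormedAddCommGroup H]
    [InnerProductSpace ℂ H] [CompleteSpace H] {S : C0Semigroup H} (hS : S.IsAnalytic)
    (hA : ∀ z : ℂ, 0 ≤ z.re → z ∈ S.generator.resolventSet) {α ρ θ : ℝ} (hα : 0 ≤ α)
    (hα1 : α ≤ 1) (hρ : 0 ≤ ρ) (hθ : 0 ≤ θ) (hβ1 : max ((θ - ρ) / 2) 0 < 1) :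
    ∃ (K : ℝ → DotH S ρ →L[ℂ] DotH S θ) (C : ℝ),
      IsCausalKernel K (α - max ((θ - ρ) / 2) 0) C ∧
      ∀ u, 0 < u → ∀ x, DotH.incl S θ (K u x) = u ^ (α - 1) • S.toFun u (DotH.incl S ρ x) := by
  obtain ⟨B, C, hC, hc, hB, hB', hfac⟩ := hS.exists_factor hA hρ hθ hβ1
  have hK := isCausalKernel_rpow_smul hα hα1 hC hc hB hB'
  set J := DotH.ofPow S θ (hS.negPow_injective hA (by linarith))
  set P := (DotH.powIsometry S ρ).toContinuousLinearMap
  -- Φ sends Q to J ∘ Q ∘ P. As J and P are isometries it does not increase norms, so the kernel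
  -- bounds carry over.
  let Φ : (H →L[ℂ] H) →L[ℂ] (DotH S ρ →L[ℂ] DotH S θ) :=
    (ContinuousLinearMap.compL ℂ (DotH S ρ) H (DotH S θ) J.toContinuousLinearMap).comp
      ((ContinuousLinearMap.compL ℂ (DotH S ρ) H H).flip P)
  have hΦ : ∀ Q, ‖Φ Q‖ ≤ ‖Q‖ := fun Q =>
    ContinuousLinearMap.opNorm_le_bound _ (norm_nonneg _) fun x =>
      (J.norm_map (Q (P x))).trans_le (Q.le_opNorm (P x))
  refine ⟨_, _, hK.map Φ hΦ, fun u hu x => ?_⟩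
  rw [if_neg (not_le.2 hu)]
  change S.negPow (θ / 2) (u ^ (α - 1) • B u (DotH.pow S ρ x)) = _
  rw [← DotH.negPow_pow, ← mul_apply_eq_comp (S.toFun u), ← hfac u hu, mul_apply_eq_comp]
  exact (S.negPow (θ / 2)).map_smul_of_tower _ _

end

theorem proposition4p2 {H : Type*} [NormedAddCommGroup H] [InnerProductSpace ℂ H] [CompleteSpace H]
    [TopologicalSpace.SeparableSpace H] (S : C0Semigroup H) (hS : S.IsAnalytic)
    (hA : ∀ z : ℂ, 0 ≤ z.re → z ∈ S.generator.resolventSet)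
    (T : ℝ) (hT : 0 < T) (p : ℝ≥0∞) [Fact (1 ≤ p)] (hp : 1 < p) (hp_top : p ≠ ∞)
    (α : ℝ) (hα : 1 / p.toReal < α) (hα_lt : α < 1)
    (ρ θ : ℝ) (hρ : 0 ≤ ρ) (hθ : 0 ≤ θ) (δ : ℝ≥0)
    (hcase :
      (ρ < θ ∧ (θ - ρ) / 2 + 1 / p.toReal < α ∧ (δ : ℝ) = α - 1 / p.toReal - (θ - ρ) / 2) ∨
      (θ = ρ ∧ (δ : ℝ) < α - 1 / p.toReal) ∨
      (θ < ρ ∧ (δ : ℝ) = α - 1 / p.toReal)) :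
    ∃ R : Lp (C0Semigroup.DotH S ρ) p (volume.restrict (Set.Ioo 0 T)) →L[ℂ]
        HolderSpace δ T (C0Semigroup.DotH S θ),
      ∀ (f : Lp (C0Semigroup.DotH S ρ) p (volume.restrict (Set.Ioo 0 T))) (t : Set.Icc (0 : ℝ) T),
        IntervalIntegrable
          (fun r : ℝ => ((t : ℝ) - r) ^ (α - 1) •
            S.toFun ((t : ℝ) - r) (C0Semigroup.DotH.incl S ρ (f r))) volume 0 t ∧
        C0Semigroup.DotH.incl S θ (HolderSpace.toCont (R f) t) =
          ∫ r in (0 : ℝ)..t, ((t : ℝ) - r) ^ (α - 1) •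
            S.toFun ((t : ℝ) - r) (C0Semigroup.DotH.incl S ρ (f r)) := by
  have hp1 : 0 < 1 / p.toReal := one_div_pos.2 (ENNReal.toReal_pos (zero_lt_one.trans hp).ne' hp_top)
  -- All three cases reduce to these inequalities for the loss β = max((θ-ρ)/2, 0).
  have hexp : max ((θ - ρ) / 2) 0 < 1 ∧ 1 / p.toReal < α - max ((θ - ρ) / 2) 0 ∧
      (δ : ℝ) ≤ α - max ((θ - ρ) / 2) 0 - 1 / p.toReal := by
    rcases hcase with ⟨h1, h2, h3⟩ | ⟨h1, h2⟩ | ⟨h1, h2⟩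
    · rw [max_eq_left (by linarith)]
      exact ⟨by linarith, by linarith, by linarith⟩
    · rw [max_eq_right (by linarith)]
      exact ⟨one_pos, by linarith, by linarith⟩
    · rw [max_eq_right (by linarith)]
      exact ⟨one_pos, by linarith, by linarith⟩
  obtain ⟨hβ1, ha, hδ⟩ := hexp
  have ha1 : α - max ((θ - ρ) / 2) 0 ≤ 1 := by linarith [le_max_right ((θ - ρ) / 2) 0]
  obtain ⟨K, C, hK, hKeq⟩ := hS.exists_kernel hA (hp1.trans hα).le hα_lt.le hρ hθ hβ1
  obtain ⟨R, hR⟩ := hK.exists_convolution hT hp hp_top ha ha1 hδ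
  refine ⟨R, fun f t => ?_⟩
  obtain ⟨hint, hval⟩ := hR f t
  have ht0 : (0 : ℝ) ≤ t := t.2.1
  have hsub : Set.Ioo (0 : ℝ) t ⊆ Set.Ioo 0 T := Set.Ioo_subset_Ioo_right t.2.2
  have := C0Semigroup.DotH.completeSpace (S := S) (hS.negPow_injective hA (show 0 ≤ θ / 2 by linarith))
  -- The inclusion into H, written as (-A)^{-θ/2} after the isometry (-A)^{θ/2} so that it is
  -- visibly bounded.
  let ι : C0Semigroup.DotH S θ →L[ℂ] H :=
    (S.negPow (θ / 2)).comp (C0Semigroup.DotH.powIsometry S θ).toContinuousLinearMap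
  have hι : ∀ x, ι x = C0Semigroup.DotH.incl S θ x := C0Semigroup.DotH.negPow_pow θ
  have hG : ∀ r ∈ Set.Ioo (0 : ℝ) t, ι (K (t - r) (f r)) =
      ((t : ℝ) - r) ^ (α - 1) • S.toFun ((t : ℝ) - r) (C0Semigroup.DotH.incl S ρ (f r)) := fun r hr => by
    rw [hι, hKeq _ (sub_pos.2 hr.2)]
  have hιint := ι.integrable_comp hint
  constructor
  · rw [intervalIntegrable_iff_integrableOn_Ioc_of_le ht0, integrableOn_Ioc_iff_integrableOn_Ioo]
    exact IntegrableOn.congr_fun (IntegrableOn.mono_set hιint hsub) hG measurableSet_Ioo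
  · rw [hval, ← hι, ← ι.integral_comp_comm hint, intervalIntegral.integral_of_le ht0,
      integral_Ioc_eq_integral_Ioo, ← setIntegral_congr_fun measurableSet_Ioo hG]
    -- Causality: for t ≤ r < T the kernel vanishes, so the integral over (0, T) is the one over (0,
    -- t).
    refine setIntegral_eq_of_subset_of_forall_sdiff_eq_zero measurableSet_Ioo hsub fun r hr => ?_
    rw [hK.zero _ (by by_contra! h; exact hr.2 ⟨hr.1.1, by linarith⟩)]
    simp
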